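/- Let $(\mathcal F,\delta)$ be an ordinary differential field of characteristic $0$ and let $u$ be an element of a differential extension field of $\mathcal F$ that is differentially transcendental over $\mathcal F$. For $a$'s in that field write $\mathcal F\langle a_1,\dots\rangle$ for the differential field generated by them over $\mathcal F$. For a differential polynomial $f$, $\mathrm{ord}_z f$ is the largest $k$ such that $z^{(k)}$ occurs in $f$ ($-\infty$ if none does), and $\mathrm{ord}\,f$ is the maximum of its orders in all variables. For $P,Q\in\mathcal F\{u\}$ with $Q\ne0$ and $\gcd(P,Q)=1$ put $\mathrm{ord}(P/Q)=\max\{\mathrm{ord}_uP,\mathrm{ord}_uQ\}$. A linear differential rational parametrization is a pair $\mathcal P(u)=\left(\frac{P_1(u)}{Q_1(u)},\frac{P_2(u)}{Q_2(u)}\right)\in\mathcal F\langle u\rangle^2\setminus\mathcal F^2$ such that for $i=1,2$ the differential polynomials $P_i,Q_i\in\mathcal F\{u\}$ have degree at most $1$ and $\gcd(P_i,Q_i)=1$, $Q_i\neq 0$. It is proper if $\mathcal F\langle P_1(u)/Q_1(u),P_2(u)/Q_2(u)\rangle=\mathcal F\langle u\rangle$. For differential polynomials $f_1,f_2$ of degree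 at most $1$ in $u$ and its derivatives and of orders $m_1,m_2\ge 0$ in $u$ over a differential domain, $\delta\text{-}\mathrm{Res}_u(f_1,f_2)$ is the determinant of the matrix of size $m_1+m_2+2$ whose rows are the coefficient vectors of $f_1^{(m_2)},\dots,f_1',f_1,f_2^{(m_1)},\dots,f_2',f_2$ with respect to $u^{(m_1+m_2)},\dots,u',u,1$. **Theorem.** Let $\mathcal P(u)$ be a linear differential rational parametrization with $m_i=\mathrm{ord}(P_i/Q_i)\ge0$ for $i=1,2$, and let $$R=\delta\text{-}\mathrm{Res}_u\big(xQ_1(u)-P_1(u),\,yQ_2(u)-P_2(u)\big)\in\mathcal F\{x,y\}.$$ 1. $R$ is the determinant of the differential resultant matrix of size $m_1+m_2+2$ of the two polynomials. 2. $\mathcal P(u)$ is proper if and only if $$R\neq0,\qquad \mathrm{ord}_xR=\mathrm{ord}(P_2/Q_2),\qquad \mathrm{ord}_yR=\mathrm{ord}(P_1/Q_1).$$ 3. If these conditions hold, then the curve with generic point $\mathcal P(u)$ has an implicit equation, and an $A\in\mathcal F\{x,y\}$ is an implicit equation of it if and only if $A$ is the main irreducible factor of $R$, that is, $A$ is irreducible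 and $R=AB$ for some $B$ with $\mathrm{ord}\,B<\mathrm{ord}\,R$. Here $A$ is an implicit equation if it is irreducible and $\{f\in\mathcal F\{x,y\}: f(\mathcal P(u))=0\}=[A]:S_A^\infty$ for the separant $S_A=\partial A/\partial z^{(\mathrm{ord}_zA)}$ of $A$ with respect to each variable $z\in\{x,y\}$ that occurs in $A$, with $[A]$ the differential ideal generated by $A$. Thus properness is decided, and in the proper case the implicit equation is found, by computing this one determinant, reading off its orders and taking its main irreducible factor. -/

import Mathlib

noncomputable section

/-- The differential polynomial ring `R{yᵢ : i ∈ σ}`: the polynomial ring over `R` in the variables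
`yᵢ⁽ᵏ⁾ = X (i, k)`. -/
abbrev DiffPoly (σ R : Type*) [CommRing R] : Type _ := MvPolynomial (σ × ℕ) R

/-- The additive map on polynomials that differentiates every coefficient. -/
def coeffDerivHom (τ R : Type*) [CommRing R] [Differential R] :
    MvPolynomial τ R →ₗ[ℤ] MvPolynomial τ R :=
  AddMonoidHom.toIntLinearMap
    { toFun := fun f => ∑ s ∈ f.support, MvPolynomial.monomial s (Differential.deriv (f.coeff s))
      map_zero' := by simp
      map_add' := by
        classical
        have key : ∀ (f : MvPolynomial τ R) (s : τ →₀ ℕ),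
            (∑ t ∈ f.support, MvPolynomial.monomial t (Differential.deriv (f.coeff t))).coeff s =
              Differential.deriv (f.coeff s) := by
          intro f s
          rw [MvPolynomial.coeff_sum]
          simp only [MvPolynomial.coeff_monomial, Finset.sum_ite_eq']
          split_ifs with h
          · rfl
          · rw [MvPolynomial.notMem_support_iff.mp h, map_zero]
        intro f g
        ext s
        rw [MvPolynomial.coeff_add, key, key, key, MvPolynomial.coeff_add, map_add] }

theorem coeff_coeffDerivHom {τ R : Type*} [CommRing R] [Differential R]
    (f : MvPolynomial τ R) (s : τ →₀ ℕ) :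
    (coeffDerivHom τ R f).coeff s = Differential.deriv (f.coeff s) := by
  classical
  change (∑ t ∈ f.support, MvPolynomial.monomial t (Differential.deriv (f.coeff t))).coeff s = _
  rw [MvPolynomial.coeff_sum]
  simp only [MvPolynomial.coeff_monomial, Finset.sum_ite_eq']
  split_ifs with h
  · rfl
  · rw [MvPolynomial.notMem_support_iff.mp h, map_zero]

/-- Differentiation of the coefficients, as a derivation. -/
def coeffDerivation (τ R : Type*) [CommRing R] [Differential R] :
    Derivation ℤ (MvPolynomial τ R) (MvPolynomial τ R) :=
  Derivation.mk' (coeffDerivHom τ R) (by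
    classical
    intro f g
    ext s
    simp only [smul_eq_mul, MvPolynomial.coeff_add]
    rw [coeff_coeffDerivHom, mul_comm g, MvPolynomial.coeff_mul, MvPolynomial.coeff_mul,
      MvPolynomial.coeff_mul, map_sum, ← Finset.sum_add_distrib]
    refine Finset.sum_congr rfl fun p _ => ?_
    rw [Derivation.leibniz, coeff_coeffDerivHom, coeff_coeffDerivHom, smul_eq_mul, smul_eq_mul]
    ring)

/-- The derivation of `R{yᵢ : i ∈ σ}`: it extends the derivation of `R` and sends `yᵢ⁽ᵏ⁾` to
`yᵢ⁽ᵏ⁺¹⁾` (see `deriv_diffPoly_C` and `deriv_diffPoly_X`). -/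
instance diffPolyDifferential (σ R : Type*) [CommRing R] [Differential R] :
    Differential (DiffPoly σ R) where
  deriv := coeffDerivation (σ × ℕ) R +
    (MvPolynomial.mkDerivation R
      (fun v : σ × ℕ => (MvPolynomial.X (v.1, v.2 + 1) : DiffPoly σ R))).restrictScalars ℤ

theorem deriv_diffPoly_C {σ R : Type*} [CommRing R] [Differential R] (a : R) :
    Differential.deriv (MvPolynomial.C a : DiffPoly σ R) =
      MvPolynomial.C (Differential.deriv a) := by
  classical
  have h : coeffDerivHom (σ × ℕ) R (MvPolynomial.C a) = MvPolynomial.C (Differential.deriv a) := by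
    ext s
    rw [coeff_coeffDerivHom, MvPolynomial.coeff_C, MvPolynomial.coeff_C]
    split_ifs <;> simp
  change coeffDerivHom (σ × ℕ) R (MvPolynomial.C a) + MvPolynomial.mkDerivation R _
    (MvPolynomial.C a) = _
  rw [h, MvPolynomial.derivation_C, add_zero]

theorem deriv_diffPoly_X {σ R : Type*} [CommRing R] [Differential R] (i : σ) (k : ℕ) :
    Differential.deriv (MvPolynomial.X (i, k) : DiffPoly σ R) = MvPolynomial.X (i, k + 1) := by
  classical
  have h : coeffDerivHom (σ × ℕ) R (MvPolynomial.X (i, k)) = 0 := by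
    ext s
    rw [coeff_coeffDerivHom, MvPolynomial.coeff_X, MvPolynomial.coeff_zero]
    split_ifs <;> simp
  change coeffDerivHom (σ × ℕ) R (MvPolynomial.X (i, k)) + MvPolynomial.mkDerivation R _
    (MvPolynomial.X (i, k)) = _
  rw [h, MvPolynomial.mkDerivation_X, zero_add]

/-- The `k`-th derivative `a⁽ᵏ⁾`. -/
def iterDeriv {A : Type*} [CommRing A] [Differential A] (k : ℕ) (a : A) : A :=
  (fun b : A => Differential.deriv b)^[k] a

/-- `ord_{yᵢ} f`: the largest `k` such that `yᵢ⁽ᵏ⁾` occurs in `f`, and `⊥` (that is, `-∞`) if no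
derivative of `yᵢ` occurs in `f`. -/
def ordIn {σ R : Type*} [DecidableEq σ] [CommRing R] (i : σ) (f : DiffPoly σ R) : WithBot ℕ :=
  (f.vars.filter fun v => v.1 = i).sup fun v => ((v.2 : ℕ) : WithBot ℕ)

/-- `ord f`, the maximum of the orders of `f` in all the variables. -/
def ordTotal {σ R : Type*} [CommRing R] (f : DiffPoly σ R) : WithBot ℕ :=
  f.vars.sup fun v => ((v.2 : ℕ) : WithBot ℕ)

/-- The value `f(η)` of a differential polynomial at a point `η` of a differential extension. -/
def evalAt {σ F K : Type*} [CommRing F] [CommRing K] [Algebra F K] [Differential K]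
    (η : σ → K) (f : DiffPoly σ F) : K :=
  MvPolynomial.aeval (fun v : σ × ℕ => iterDeriv v.2 (η v.1)) f

/-- `u` is differentially transcendental over `F`: the family `u, u′, u″, …` is algebraically
independent over `F`. -/
def DiffTranscendental (F : Type*) {K : Type*} [Field F] [Field K] [Algebra F K] [Differential K]
    (u : K) : Prop :=
  AlgebraicIndependent F fun k : ℕ => iterDeriv k u

/-- `F⟨S⟩`: the field generated over `F` by all derivatives of the elements of `S`. -/
def diffAdjoin (F : Type*) {K : Type*} [Field F] [Field K] [Algebra F K] [Differential K]
    (S : Set K) : IntermediateField F K :=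
  IntermediateField.adjoin F {b | ∃ a ∈ S, ∃ k : ℕ, b = iterDeriv k a}

/-- The order of the differential rational function `P/Q`, for `P, Q ∈ F{u}` without common
factor. -/
def ratOrd {F : Type*} [CommRing F] (P Q : DiffPoly Unit F) : WithBot ℕ :=
  max (ordIn () P) (ordIn () Q)

/-- `(P₀/Q₀, P₁/Q₁)` is a linear differential rational parametrization: both fractions are in
reduced form with numerator and denominator of degree at most one, and they are not both in `F`. -/
structure IsLinearParam {F : Type*} [Field F] (P Q : Fin 2 → DiffPoly Unit F) : Prop where
  den_ne_zero : ∀ i, Q i ≠ 0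
  num_degree_le : ∀ i, (P i).totalDegree ≤ 1
  den_degree_le : ∀ i, (Q i).totalDegree ≤ 1
  reduced : ∀ i, IsRelPrime (P i) (Q i)
  nonconstant : ∃ i, ratOrd (P i) (Q i) ≠ ⊥

/-- The point `(P₀(u)/Q₀(u), P₁(u)/Q₁(u))`. -/
def paramPoint {F K : Type*} [Field F] [Field K] [Algebra F K] [Differential K]
    (u : K) (P Q : Fin 2 → DiffPoly Unit F) (i : Fin 2) : K :=
  evalAt (fun _ : Unit => u) (P i) / evalAt (fun _ : Unit => u) (Q i)

/-- Properness: `F⟨P₀(u)/Q₀(u), P₁(u)/Q₁(u)⟩ = F⟨u⟩`. -/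
def IsProperParam {F K : Type*} [Field F] [Field K] [Algebra F K] [Differential K]
    (u : K) (P Q : Fin 2 → DiffPoly Unit F) : Prop :=
  diffAdjoin F (Set.range (paramPoint u P Q)) = diffAdjoin F {u}

/-- The matrix of size `m₁ + m₂ + 2` whose rows are the coefficient vectors of
`f₁⁽ᵐ²⁾, …, f₁′, f₁, f₂⁽ᵐ¹⁾, …, f₂′, f₂` with respect to `u⁽ᵐ¹⁺ᵐ²⁾, …, u′, u, 1`. -/
def diffResMatrix {D : Type*} [CommRing D] [Differential D] (f₁ f₂ : DiffPoly Unit D)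
    (m₁ m₂ : ℕ) : Matrix (Fin (m₁ + m₂ + 2)) (Fin (m₁ + m₂ + 2)) D :=
  Matrix.of fun r c =>
    (if (r : ℕ) ≤ m₂ then iterDeriv (m₂ - r) f₁ else iterDeriv (m₁ + m₂ + 1 - r) f₂).coeff
      (if (c : ℕ) ≤ m₁ + m₂ then Finsupp.single ((), m₁ + m₂ - c) 1 else 0)

/-- The differential resultant `δ-Res_u(f₁, f₂)` of two differential polynomials of degree at most
one (and of orders at least zero) in `u`. -/
def diffResultant {D : Type*} [CommRing D] [Differential D] (f₁ f₂ : DiffPoly Unit D) : D :=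
  (diffResMatrix f₁ f₂ ((ordIn () f₁).unbotD 0) ((ordIn () f₂).unbotD 0)).det

/-- The polynomials `x Q₀(u) - P₀(u)` and `y Q₁(u) - P₁(u)` in `F{x, y}{u}`, with `x` and `y` the
variables of `F{x, y}` with indices `0` and `1`. -/
def paramPoly {F : Type*} [Field F] (P Q : Fin 2 → DiffPoly Unit F) (i : Fin 2) :
    DiffPoly Unit (DiffPoly (Fin 2) F) :=
  MvPolynomial.C (MvPolynomial.X (i, 0)) * MvPolynomial.map MvPolynomial.C (Q i) -
    MvPolynomial.map MvPolynomial.C (P i)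

/-- `R = δ-Res_u(x Q₀(u) - P₀(u), y Q₁(u) - P₁(u)) ∈ F{x, y}`. -/
def paramResultant {F : Type*} [Field F] [Differential F] (P Q : Fin 2 → DiffPoly Unit F) :
    DiffPoly (Fin 2) F :=
  diffResultant (paramPoly P Q 0) (paramPoly P Q 1)

/-- The differential ideal `[A]`. -/
def diffIdeal {σ F : Type*} [Field F] [Differential F] (A : DiffPoly σ F) : Ideal (DiffPoly σ F) :=
  Ideal.span (Set.range fun k : ℕ => iterDeriv k A)

/-- The separant of `A` for the rankings in which the leader of `A` is its highest derivative of
`yᵢ` (meaningful when `A` involves `yᵢ`). -/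
def separant {σ F : Type*} [DecidableEq σ] [Field F] (i : σ) (A : DiffPoly σ F) : DiffPoly σ F :=
  MvPolynomial.pderiv (i, (ordIn i A).unbotD 0) A

/-- The saturation `[A] : S_A^∞`; for irreducible `A` this is the general component of `A`. -/
def satSet {σ F : Type*} [DecidableEq σ] [Field F] [Differential F] (i : σ) (A : DiffPoly σ F) :
    Set (DiffPoly σ F) :=
  {f | ∃ n : ℕ, separant i A ^ n * f ∈ diffIdeal A}

/-- `A` is the implicit equation of the curve with generic point `η`: `A` is irreducible and the
differential polynomials that vanish at `η` form the general component of `A`. Under any ranking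
the leader of `A` is the highest derivative of one of the variables that occur in `A`, so the
equality is demanded for each of these possible leaders. -/
def IsImplicitEquation {σ F K : Type*} [DecidableEq σ] [Field F] [Differential F] [Field K]
    [Algebra F K] [Differential K] (η : σ → K) (A : DiffPoly σ F) : Prop :=
  Irreducible A ∧ ∀ i, ordIn i A ≠ ⊥ → {f : DiffPoly σ F | evalAt η f = 0} = satSet i A

/-- `A` is the main irreducible factor of `R`: it is irreducible and `R = A B` with
`ord B < ord R`. -/
def IsMainFactor {σ F : Type*} [Field F] (A R : DiffPoly σ F) : Prop :=
  Irreducible A ∧ ∃ B, R = A * B ∧ ordTotal B < ordTotal R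

end

/-! Let η be the generic point, N = m 0 + m 1 and M the resultant matrix. The row of the k-th
derivative of the i-th polynomial, taken at η and applied to the jet (u⁽ᴺ⁾, …, u, 1), gives the k-th
derivative of ηᵢQᵢ(u) - Pᵢ(u) = 0. So the jet lies in the kernel of M(η), and R(η) = 0. The highest
derivative of x occurs in a single row of M, linearly and with the coefficients of Q₀ as its
coefficients. Hence R is that variable times `topCoeff` plus terms free of it; likewise for y.

Proper implies the criterion. A count of transcendence degrees (`eq_zero_of_evalAt_eq_zero`) shows
that a nonzero relation at η has order at least m 1 in x and at least m 0 in y. This bound makes R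
nonzero, because a vanishing determinant would produce relations of smaller order
(`det_paramMatrix_ne_zero`). As R is a relation at η of at most these orders, it attains both.

The criterion implies proper. If `topCoeff` does not vanish at η, Cramer's rule expresses u
rationally in the derivatives of η (`isProperParam_of_topCoeff_ne_zero`). The order of R in x only
says that `topCoeff` is a nonzero polynomial. To descend to η (`aeval_topCoeff_ne_zero`), solve R =
0 for the highest derivative of x over a field of rational functions. At this generic zero of R, M
has a kernel vector W ≠ 0. Counting transcendence degrees again excludes Q₁(W) = 0 and a zero last
entry. After scaling, W is thus a specialization of the jet of u that carries η to the zero of R, so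
`topCoeff` vanishing at η would vanish there too, which it does not.

Implicit equation. In the proper case R has the least possible order in every variable and degree
one in each highest derivative (`IsLinearRelation`). An irreducible factor A vanishing at η inherits
this, and the cofactor has smaller order. Pseudo-reduction modulo A turns any relation into one of
too small order, hence into zero, so the relations at η form [A] : S_A^∞. Conversely every implicit
equation is associated with A (`IsLinearRelation.dvd_of_isImplicitEquation`). -/

open MvPolynomial

/-! ### Iterated derivatives and the Leibniz rule -/

section IterDeriv

variable {A : Type*} [CommRing A] [Differential A]

@[simp]
theorem iterDeriv_zero (a : A) : iterDeriv 0 a = a := rfl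

theorem iterDeriv_succ (k : ℕ) (a : A) :
    iterDeriv (k + 1) a = Differential.deriv (iterDeriv k a) :=
  Function.iterate_succ_apply' _ _ _

theorem iterDeriv_sub (k : ℕ) (a b : A) : iterDeriv k (a - b) = iterDeriv k a - iterDeriv k b := by
  induction k with
  | zero => rfl
  | succ k ih => simp only [iterDeriv_succ, ih, map_sub]

theorem iterDeriv_zero_right (k : ℕ) : iterDeriv k (0 : A) = 0 := by
  induction k with
  | zero => rfl
  | succ k ih => simp only [iterDeriv_succ, ih, map_zero]

theorem iterDeriv_mul (n : ℕ) (a b : A) :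
    iterDeriv n (a * b) =
      ∑ p ∈ Finset.HasAntidiagonal.antidiagonal n, n.choose p.1 • (iterDeriv p.1 a * iterDeriv p.2 b) := by
  induction n with
  | zero => simp
  | succ n ih =>
    rw [Finset.sum_antidiagonal_choose_succ_nsmul (fun i j => iterDeriv i a * iterDeriv j b) n,
      iterDeriv_succ, ih, map_sum, ← Finset.sum_add_distrib]
    refine Finset.sum_congr rfl fun p hp => ?_
    rw [Finset.HasAntidiagonal.mem_antidiagonal] at hp
    rw [map_nsmul, Derivation.leibniz, smul_eq_mul, smul_eq_mul, iterDeriv_succ, iterDeriv_succ,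
      smul_add, mul_comm (iterDeriv p.2 b), Nat.choose_symm_of_eq_add hp.symm]

theorem iterDeriv_iterDeriv (k l : ℕ) (a : A) :
    iterDeriv k (iterDeriv l a) = iterDeriv (k + l) a :=
  (Function.iterate_add_apply _ k l a).symm

end IterDeriv

/-! ### Derivation, evaluation and partial derivatives of differential polynomials -/

section Evaluation

variable {σ F K : Type*} [Field F] [Differential F] [Field K] [Algebra F K] [Differential K]

theorem iterDeriv_X [DecidableEq σ] (i : σ) (j k : ℕ) :
    iterDeriv k (X (i, j) : DiffPoly σ F) = X (i, j + k) := by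
  induction k with
  | zero => rfl
  | succ k ih => rw [iterDeriv_succ, ih, deriv_diffPoly_X, add_assoc]

theorem deriv_diffPoly_C_mul (a : F) (f : DiffPoly σ F) :
    Differential.deriv (C a * f) =
      C a * Differential.deriv f + C (Differential.deriv a) * f := by
  rw [Derivation.leibniz, deriv_diffPoly_C, smul_eq_mul, smul_eq_mul, mul_comm f]

theorem evalAt_deriv [DifferentialAlgebra F K] (η : σ → K) (f : DiffPoly σ F) :
    evalAt η (Differential.deriv f) = Differential.deriv (evalAt η f) := by
  unfold evalAt
  induction f using MvPolynomial.induction_on with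
  | C a => rw [deriv_diffPoly_C, aeval_C, aeval_C, DifferentialAlgebra.deriv_algebraMap]
  | add p q hp hq => rw [map_add, map_add, map_add, map_add, hp, hq]
  | mul_X p v hp =>
    obtain ⟨i, k⟩ := v
    rw [Derivation.leibniz, deriv_diffPoly_X, map_mul, Derivation.leibniz, map_add, smul_eq_mul,
      smul_eq_mul, smul_eq_mul, smul_eq_mul, map_mul, map_mul, hp, aeval_X, aeval_X, iterDeriv_succ]

theorem evalAt_iterDeriv [DifferentialAlgebra F K] (η : σ → K) (k : ℕ) (f : DiffPoly σ F) :
    evalAt η (iterDeriv k f) = iterDeriv k (evalAt η f) := by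
  induction k with
  | zero => rfl
  | succ k ih => rw [iterDeriv_succ, evalAt_deriv, ih, iterDeriv_succ]

theorem deriv_map_C {τ : Type*} (f : DiffPoly τ F) :
    Differential.deriv (map (C : F →+* DiffPoly σ F) f : DiffPoly τ (DiffPoly σ F)) =
      map C (Differential.deriv f) := by
  induction f using MvPolynomial.induction_on with
  | C a => rw [map_C, deriv_diffPoly_C, deriv_diffPoly_C, deriv_diffPoly_C, map_C]
  | add p q hp hq => simp only [map_add, hp, hq]
  | mul_X p v hp =>
    obtain ⟨i, k⟩ := v
    rw [Derivation.leibniz, deriv_diffPoly_X, map_mul, Derivation.leibniz, map_add, smul_eq_mul,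
      smul_eq_mul, smul_eq_mul, smul_eq_mul, map_mul, map_mul, hp, map_X, map_X, deriv_diffPoly_X]

theorem iterDeriv_map_C {τ : Type*} (k : ℕ) (f : DiffPoly τ F) :
    iterDeriv k (map (C : F →+* DiffPoly σ F) f : DiffPoly τ (DiffPoly σ F)) =
      map C (iterDeriv k f) := by
  induction k with
  | zero => rfl
  | succ k ih => rw [iterDeriv_succ, ih, deriv_map_C, iterDeriv_succ]

theorem iterDeriv_C {τ : Type*} (k : ℕ) (a : DiffPoly σ F) :
    iterDeriv k (C a : DiffPoly τ (DiffPoly σ F)) = C (iterDeriv k a) := by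
  induction k with
  | zero => rfl
  | succ k ih => rw [iterDeriv_succ, ih, deriv_diffPoly_C, iterDeriv_succ]

/-- The extra term arises because the derivation turns zᵢ⁽ᵏ⁾ into zᵢ⁽ᵏ⁺¹⁾. It is the source of the
fact that the separant is the leading coefficient of every proper derivative. -/
theorem pderiv_deriv_succ [DecidableEq σ] (i : σ) (k : ℕ) (f : DiffPoly σ F) :
    pderiv (i, k + 1) (Differential.deriv f) =
      Differential.deriv (pderiv (i, k + 1) f) + pderiv (i, k) f := by
  induction f using MvPolynomial.induction_on with
  | C a => rw [deriv_diffPoly_C, pderiv_C, pderiv_C, pderiv_C, map_zero, add_zero]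
  | add p q hp hq => simp only [map_add, hp, hq]; ring
  | mul_X p v hp =>
    obtain ⟨j, l⟩ := v
    have h : (pderiv (i, k + 1) (X (j, l + 1)) : DiffPoly σ F) = pderiv (i, k) (X (j, l)) := by
      simp only [pderiv_X, Pi.single_apply, Prod.mk.injEq, add_left_inj]
    have h' : Differential.deriv (pderiv (i, k + 1) (X (j, l)) : DiffPoly σ F) = 0 := by
      simp only [pderiv_X, Pi.single_apply]
      split_ifs <;> simp
    simp only [Derivation.leibniz, deriv_diffPoly_X, map_add, smul_eq_mul, hp, h, h']
    ring

end Evaluation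

section Supported

variable {σ F : Type*} [Field F] [Differential F]

theorem deriv_mem_supported {s t : Set (σ × ℕ)} (hst : ∀ i k, (i, k) ∈ s → (i, k) ∈ t ∧ (i, k + 1) ∈ t)
    {f : DiffPoly σ F} (hf : f ∈ supported F s) : Differential.deriv f ∈ supported F t := by
  have hle : supported F s ≤ supported F t := supported_mono fun v hv => (hst v.1 v.2 hv).1
  rw [supported_eq_adjoin_X] at hf
  induction hf using Algebra.adjoin_induction with
  | mem x hx =>
    obtain ⟨⟨i, k⟩, hv, rfl⟩ := hx
    rw [deriv_diffPoly_X]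
    exact X_mem_supported.2 (hst i k hv).2
  | algebraMap r =>
    rw [algebraMap_eq, deriv_diffPoly_C]
    exact (supported F t).algebraMap_mem _
  | add x y _ _ hx hy => rw [map_add]; exact add_mem hx hy
  | mul x y hx hy hx' hy' =>
    rw [← supported_eq_adjoin_X] at hx hy
    rw [Derivation.leibniz]
    exact add_mem (mul_mem (hle hx) hy') (mul_mem (hle hy) hx')

end Supported

theorem pderiv_eq_zero_of_mem_supported {σ F : Type*} [Field F] {s : Set (σ × ℕ)}
    {f : DiffPoly σ F} (hf : f ∈ supported F s) {v : σ × ℕ} (hv : v ∉ s) : pderiv v f = 0 :=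
  pderiv_eq_zero_of_notMem_vars fun h => hv (mem_supported.1 hf h)

/-! ### Affine forms in the derivatives of u -/

/-- The differential polynomials of degree at most one and of order less than `n`. -/
noncomputable def linForms (F : Type*) [Field F] (n : ℕ) : Submodule F (DiffPoly Unit F) :=
  Submodule.span F (insert 1 ((fun k => X ((), k)) '' Set.Iio n))

section LinForms

variable {F : Type*} [Field F]

theorem one_mem_linForms (n : ℕ) : (1 : DiffPoly Unit F) ∈ linForms F n :=
  Submodule.subset_span (Set.mem_insert _ _)

theorem C_mem_linForms (n : ℕ) (a : F) : (C a : DiffPoly Unit F) ∈ linForms F n := by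
  have := (linForms F n).smul_mem a (one_mem_linForms n)
  rwa [smul_eq_C_mul, mul_one] at this

theorem X_mem_linForms {n k : ℕ} (h : k < n) : (X ((), k) : DiffPoly Unit F) ∈ linForms F n :=
  Submodule.subset_span (Set.mem_insert_of_mem _ ⟨k, h, rfl⟩)

theorem linForms_mono {n n' : ℕ} (h : n ≤ n') : linForms F n ≤ linForms F n' :=
  Submodule.span_mono (Set.insert_subset_insert (Set.image_mono (Set.Iio_subset_Iio h)))

theorem mem_linForms_of_totalDegree_le {f : DiffPoly Unit F} {n : ℕ} (hf : f.totalDegree ≤ 1)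
    (hn : ∀ k, ((), k) ∈ f.vars → k < n) : f ∈ linForms F n := by
  classical
  rw [f.as_sum]
  refine sum_mem fun s hs => ?_
  have hd : (s.sum fun _ e => e) ≤ 1 := (le_totalDegree hs).trans hf
  rcases Nat.le_one_iff_eq_zero_or_eq_one.1 hd with h | h
  · have h0 : s = 0 := by
      ext v
      by_contra hv
      have hv' : v ∈ s.support := Finsupp.mem_support_iff.2 hv
      exact hv (Finset.sum_eq_zero_iff.1 h v hv')
    rw [h0]
    exact C_mem_linForms n _
  · obtain ⟨⟨⟨⟩, k⟩, rfl⟩ := (Finsupp.sum_eq_one_iff s).1 h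
    have hk : k < n := hn k ((mem_vars_iff_mem_support _).2 ⟨_, hs, by simp⟩)
    have := (linForms F n).smul_mem (f.coeff (Finsupp.single ((), k) 1)) (X_mem_linForms hk)
    rwa [smul_eq_C_mul, C_mul_X_eq_monomial] at this

theorem deriv_mem_linForms [Differential F] {f : DiffPoly Unit F} {n : ℕ} (hf : f ∈ linForms F n) :
    Differential.deriv f ∈ linForms F (n + 1) := by
  have hle := linForms_mono (F := F) (Nat.le_succ n)
  refine Submodule.span_induction (p := fun f _ => f ∈ linForms F n ∧
    Differential.deriv f ∈ linForms F (n + 1)) ?_ ?_ ?_ ?_ hf |>.2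
  · rintro _ (rfl | ⟨k, hk, rfl⟩)
    · exact ⟨one_mem_linForms n, by simp⟩
    · refine ⟨X_mem_linForms hk, ?_⟩
      rw [deriv_diffPoly_X]
      exact X_mem_linForms (Nat.succ_lt_succ hk)
  · simp
  · rintro x y - - ⟨h1, h2⟩ ⟨h3, h4⟩
    exact ⟨add_mem h1 h3, by rw [map_add]; exact add_mem h2 h4⟩
  · rintro a x - ⟨h1, h2⟩
    refine ⟨Submodule.smul_mem _ _ h1, ?_⟩
    rw [smul_eq_C_mul, deriv_diffPoly_C_mul, ← smul_eq_C_mul, ← smul_eq_C_mul]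
    exact add_mem (Submodule.smul_mem _ _ h2) (Submodule.smul_mem _ _ (hle h1))

theorem iterDeriv_mem_linForms [Differential F] {f : DiffPoly Unit F} {n : ℕ}
    (hf : f ∈ linForms F n) (k : ℕ) : iterDeriv k f ∈ linForms F (n + k) := by
  induction k with
  | zero => exact hf
  | succ k ih => rw [iterDeriv_succ]; exact deriv_mem_linForms ih

theorem coeff_single_of_mem_linForms {f : DiffPoly Unit F} {n k : ℕ} (hf : f ∈ linForms F n)
    (hk : n ≤ k) : f.coeff (Finsupp.single ((), k) 1) = 0 := by
  have : linForms F n ≤ LinearMap.ker (lcoeff F (Finsupp.single ((), k) 1)) := by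
    refine Submodule.span_le.2 ?_
    rintro _ (rfl | ⟨l, hl, rfl⟩)
    · simp [coeff_one, (Finsupp.single_ne_zero.2 (one_ne_zero' ℕ)).symm]
    · have : l ≠ k := (lt_of_lt_of_le hl hk).ne
      simp [coeff_X, Finsupp.single_left_inj, this]
  exact this hf

theorem sub_leading_mem_linForms {f : DiffPoly Unit F} {n : ℕ} (hf : f ∈ linForms F (n + 1)) :
    f - C (f.coeff (Finsupp.single ((), n) 1)) * X ((), n) ∈ linForms F n := by
  have : linForms F (n + 1) ≤ (linForms F n).comap (LinearMap.id -
      (lcoeff F (Finsupp.single ((), n) 1)).smulRight (X ((), n))) := by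
    refine Submodule.span_le.2 ?_
    rintro _ (rfl | ⟨l, hl, rfl⟩)
    · simpa [coeff_one, (Finsupp.single_ne_zero.2 (one_ne_zero' ℕ)).symm] using one_mem_linForms n
    · rcases (Nat.lt_succ_iff.1 hl).eq_or_lt with rfl | h
      · simp
      · simpa [coeff_X, Finsupp.single_left_inj, h.ne] using X_mem_linForms (F := F) h
  simpa [smul_eq_C_mul] using this hf

/-- Differentiation raises the order by one and keeps the leading coefficient; the derivative of
that coefficient only multiplies a lower derivative of u. -/
theorem iterDeriv_sub_leading_mem_linForms [Differential F] {f : DiffPoly Unit F} {n : ℕ}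
    (hf : f ∈ linForms F (n + 1)) (k : ℕ) :
    iterDeriv k f - C (f.coeff (Finsupp.single ((), n) 1)) * X ((), n + k) ∈
      linForms F (n + k) := by
  induction k with
  | zero => exact sub_leading_mem_linForms hf
  | succ k ih =>
    have h := deriv_mem_linForms ih
    rw [map_sub, deriv_diffPoly_C_mul, deriv_diffPoly_X, ← iterDeriv_succ] at h
    have h' := add_mem h ((linForms F (n + k + 1)).smul_mem
      (Differential.deriv (f.coeff (Finsupp.single ((), n) 1)))
      (X_mem_linForms (Nat.lt_succ_self (n + k))))
    rw [smul_eq_C_mul] at h'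
    rw [← add_assoc]
    convert h' using 1
    ring

theorem coeff_iterDeriv_leading [Differential F] {f : DiffPoly Unit F} {n : ℕ}
    (hf : f ∈ linForms F (n + 1)) (k : ℕ) :
    (iterDeriv k f).coeff (Finsupp.single ((), n + k) 1) =
      f.coeff (Finsupp.single ((), n) 1) := by
  have h := coeff_single_of_mem_linForms (iterDeriv_sub_leading_mem_linForms hf k) le_rfl
  rwa [coeff_sub, coeff_C_mul, coeff_X, if_pos rfl, mul_one, sub_eq_zero] at h

end LinForms

/-! ### Affine forms as functionals on vectors indexed by the columns -/

/-- The exponents of the monomials `u⁽ᴺ⁾, …, u′, u, 1`. -/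
noncomputable def colExp (N : ℕ) (c : Fin (N + 2)) : Unit × ℕ →₀ ℕ :=
  if (c : ℕ) ≤ N then Finsupp.single ((), N - c) 1 else 0

/-- The vector `(w N, …, w 1, w 0, 1)`. -/
noncomputable def jetVec {L : Type*} [One L] (N : ℕ) (w : ℕ → L) (c : Fin (N + 2)) : L :=
  if (c : ℕ) ≤ N then w (N - c) else 1

/-- The linear functional that sends the monomials `u⁽ᴺ⁾, …, u′, u, 1` to the entries of `W`. -/
noncomputable def linEval (F : Type*) {L : Type*} [Field F] [Field L] [Algebra F L] (N : ℕ)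
    (W : Fin (N + 2) → L) : DiffPoly Unit F →ₗ[F] L :=
  ∑ c, (lcoeff F (colExp N c)).smulRight (W c)

section LinEval

variable {F L : Type*} [Field F] [Field L] [Algebra F L] {N : ℕ}

theorem linEval_apply (W : Fin (N + 2) → L) (f : DiffPoly Unit F) :
    linEval F N W f = ∑ c, algebraMap F L (f.coeff (colExp N c)) * W c := by
  simp [linEval, Algebra.smul_def]

theorem linEval_one (W : Fin (N + 2) → L) : linEval F N W 1 = W (Fin.last _) := by
  rw [linEval_apply, Finset.sum_eq_single (Fin.last (N + 1))]
  · simp [colExp]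
  · intro c _ hc
    have : (c : ℕ) ≤ N := by
      have := Fin.val_lt_last hc
      omega
    simp [colExp, this, coeff_one, (Finsupp.single_ne_zero.2 (one_ne_zero' ℕ)).symm]
  · simp

theorem linEval_X (W : Fin (N + 2) → L) (c : Fin (N + 2)) (hc : (c : ℕ) ≤ N) :
    linEval F N W (X ((), N - c)) = W c := by
  rw [linEval_apply, Finset.sum_eq_single c]
  · simp [colExp, hc]
  · intro d _ hd
    by_cases h : (d : ℕ) ≤ N
    · have : N - (c : ℕ) ≠ N - d := fun h' => hd (Fin.ext (by omega))
      simp [colExp, h, coeff_X, Finsupp.single_left_inj, this]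
    · simp [colExp, h, coeff_X]
  · simp

theorem linEval_jetVec (w : ℕ → L) {f : DiffPoly Unit F} (hf : f ∈ linForms F (N + 1)) :
    linEval F N (jetVec N w) f = aeval (fun v : Unit × ℕ => w v.2) f := by
  have : linForms F (N + 1) ≤ LinearMap.ker (linEval F N (jetVec N w) -
      (aeval (fun v : Unit × ℕ => w v.2) : DiffPoly Unit F →ₐ[F] L).toLinearMap) := by
    refine Submodule.span_le.2 ?_
    rintro _ (rfl | ⟨k, hk, rfl⟩)
    · simp [linEval_one, jetVec]
    · have hk' : k ≤ N := Nat.lt_succ_iff.1 hk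
      have := linEval_X (F := F) (jetVec N w) ⟨N - k, by omega⟩ (by simp)
      simp only [Nat.sub_sub_self hk'] at this
      simp [this, jetVec, Nat.sub_sub_self hk']
  exact sub_eq_zero.1 (this hf)

theorem linEval_jetVec_evalAt [Differential L] (u : L) {f : DiffPoly Unit F}
    (hf : f ∈ linForms F (N + 1)) :
    linEval F N (jetVec N fun k => iterDeriv k u) f = evalAt (fun _ => u) f :=
  linEval_jetVec _ hf

end LinEval

/-! ### Relative algebraic closure and transcendence degree -/

/-- The elements of `K` that are algebraic over `F(S)`. -/
noncomputable def algCl (F : Type*) {K : Type*} [Field F] [Field K] [Algebra F K] (S : Set K) :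
    IntermediateField F K :=
  ((Subalgebra.algebraicClosure (Algebra.adjoin F S) K).restrictScalars F).toIntermediateField
    fun _ hx => IsAlgebraic.inv hx

section AlgCl

variable {F K : Type*} [Field F] [Field K] [Algebra F K]

theorem mem_algCl {S : Set K} {a : K} : a ∈ algCl F S ↔ IsAlgebraic (Algebra.adjoin F S) a :=
  Iff.rfl

/-- Gives access to the exchange, finiteness and rank properties of matroid closure. -/
theorem coe_algCl (S : Set K) :
    (algCl F S : Set K) = (AlgebraicIndependent.matroid F K).closure S := by
  rw [AlgebraicIndependent.matroid_closure_eq]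
  rfl

theorem subset_algCl (S : Set K) : S ⊆ algCl F S := by
  rw [coe_algCl]
  exact Matroid.subset_closure _ _ (by simp)

theorem algCl_mono {S T : Set K} (h : S ⊆ T) : algCl F S ≤ algCl F T := by
  rw [← SetLike.coe_subset_coe, coe_algCl, coe_algCl]
  exact Matroid.closure_subset_closure _ h

theorem exists_finite_mem_algCl {S : Set K} {a : K} (h : a ∈ algCl F S) :
    ∃ T ⊆ S, T.Finite ∧ a ∈ algCl F T := by
  have h' : a ∈ (algCl F S : Set K) := h
  rw [coe_algCl] at h'
  obtain ⟨T, h1, h2, h3⟩ := Matroid.exists_mem_finite_closure_of_mem_closure h'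
  refine ⟨T, h1, h2, ?_⟩
  rw [← coe_algCl] at h3
  exact h3.2

theorem card_le_of_forall_mem_algCl {ι : Type*} [Fintype ι] {a : ι → K}
    (ha : AlgebraicIndependent F a) {T : Set K} (hT : T.Finite) (h : ∀ i, a i ∈ algCl F T) :
    Fintype.card ι ≤ T.ncard := by
  have hi : (AlgebraicIndependent.matroid F K).Indep (Set.range a) :=
    AlgebraicIndependent.matroid_indep_iff.2 ha.to_subtype_range
  have hs : Set.range a ⊆ (AlgebraicIndependent.matroid F K).closure T := by
    rw [← coe_algCl]
    rintro _ ⟨i, rfl⟩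
    exact h i
  have h1 := hi.encard_le_eRk_of_subset hs
  rw [Matroid.eRk_closure_eq] at h1
  have h2 := h1.trans (Matroid.eRk_le_encard _ T)
  rw [← Set.image_univ, ha.injective.injOn.encard_image, Set.encard_univ, ENat.card_eq_coe_fintype_card,
    ← hT.cast_ncard_eq] at h2
  exact_mod_cast h2

/-- Differentiating p(a) = 0 gives p′(a) · a′ in terms of a and the derivatives of the coefficients
of p. In characteristic 0 one can choose p with p′(a) ≠ 0 and divide. -/
theorem deriv_mem_algCl [CharZero F] [Differential F] [Differential K] [DifferentialAlgebra F K]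
    {S : Set K} (hS : ∀ s ∈ S, Differential.deriv s ∈ algCl F S) {a : K} (ha : a ∈ algCl F S) :
    Differential.deriv a ∈ algCl F S := by
  have hadj : ∀ b ∈ Algebra.adjoin F S, Differential.deriv b ∈ algCl F S := by
    intro b hb
    have hle : Algebra.adjoin F S ≤ (algCl F S).toSubalgebra := Algebra.adjoin_le (subset_algCl S)
    induction hb using Algebra.adjoin_induction with
    | mem x hx => exact hS x hx
    | algebraMap r =>
      rw [DifferentialAlgebra.deriv_algebraMap]
      exact (algCl F S).algebraMap_mem _
    | add x y _ _ hx hy => rw [map_add]; exact add_mem hx hy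
    | mul x y hx hy hx' hy' =>
      rw [Derivation.leibniz]
      exact add_mem (mul_mem (hle hx) hy') (mul_mem (hle hy) hx')
  have hpoly : ∀ p : Polynomial (Algebra.adjoin F S), Differential.deriv (Polynomial.aeval a p) -
      Polynomial.aeval a (Polynomial.derivative p) * Differential.deriv a ∈ algCl F S := by
    intro p
    induction p using Polynomial.induction_on' with
    | add p q hp hq =>
      convert add_mem hp hq using 1
      simp only [map_add]
      ring
    | monomial n c =>
      have h1 : (c : K) ∈ algCl F S :=
        Algebra.adjoin_le (S := (algCl F S).toSubalgebra) (subset_algCl S) c.2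
      convert mul_mem (pow_mem ha n) (hadj c c.2) using 1
      rw [Polynomial.aeval_monomial, Polynomial.derivative_monomial, Polynomial.aeval_monomial,
        Derivation.leibniz, Derivation.leibniz_pow]
      have hc : algebraMap (Algebra.adjoin F S) K c = c := rfl
      simp only [map_mul, map_natCast, smul_eq_mul, nsmul_eq_mul, hc]
      ring
  have : CharZero (Algebra.adjoin F S) :=
    charZero_of_injective_algebraMap (algebraMap F (Algebra.adjoin F S)).injective
  have key : ∀ n, ∀ p : Polynomial (Algebra.adjoin F S), p.natDegree = n → p ≠ 0 →
      Polynomial.aeval a p = 0 → Differential.deriv a ∈ algCl F S := by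
    intro n
    induction n using Nat.strong_induction_on with
    | _ n ih =>
      intro p hn hp h0
      have hdeg : p.natDegree ≠ 0 := by
        intro hd
        obtain ⟨c, rfl⟩ := Polynomial.natDegree_eq_zero.1 hd
        rw [Polynomial.aeval_C] at h0
        have : c = 0 := Subtype.ext h0
        exact hp (by rw [this, Polynomial.C_0])
      by_cases hd : Polynomial.aeval a (Polynomial.derivative p) = 0
      -- If p′(a) = 0, then p′ is itself an annihilating polynomial of smaller degree, nonzero
      -- because the characteristic is 0.
      · refine ih _ (hn ▸ Polynomial.natDegree_derivative_lt hdeg) _ rfl ?_ hd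
        intro h
        exact hdeg (Polynomial.derivative_eq_zero.1 h)
      · have h1 := hpoly p
        rw [h0, map_zero, zero_sub, neg_mem_iff] at h1
        have h2 : Polynomial.aeval a (Polynomial.derivative p) ∈ algCl F S := by
          rw [Polynomial.aeval_eq_sum_range]
          refine sum_mem fun i _ => ?_
          rw [Algebra.smul_def]
          refine mul_mem ?_ (pow_mem ha i)
          exact Algebra.adjoin_le (S := (algCl F S).toSubalgebra) (subset_algCl S)
            (Subtype.mem _)
        have h3 := mul_mem (inv_mem h2) h1
        rwa [inv_mul_cancel_left₀ hd] at h3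
  obtain ⟨p, hp, h0⟩ := mem_algCl.1 ha
  exact key _ p rfl hp h0

theorem iterDeriv_mem_algCl [CharZero F] [Differential F] [Differential K]
    [DifferentialAlgebra F K] {S : Set K} (hS : ∀ s ∈ S, Differential.deriv s ∈ algCl F S) {a : K}
    (ha : a ∈ algCl F S) (k : ℕ) : iterDeriv k a ∈ algCl F S := by
  induction k with
  | zero => exact ha
  | succ k ih => rw [iterDeriv_succ]; exact deriv_mem_algCl hS ih

end AlgCl

/-! ### Recovering derivatives of u from a linear fraction in u -/

section LinearFractions

variable {F K : Type*} [Field F] [Field K] [Algebra F K] [Differential K]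

theorem DiffTranscendental.evalAt_ne_zero {u : K} (hu : DiffTranscendental F u)
    {f : DiffPoly Unit F} (hf : f ≠ 0) : evalAt (fun _ => u) f ≠ 0 := by
  have h : AlgebraicIndependent F fun v : Unit × ℕ => iterDeriv v.2 u :=
    AlgebraicIndependent.comp hu (fun v : Unit × ℕ => v.2) fun v w hvw => Prod.ext rfl hvw
  intro h0
  exact hf ((injective_iff_map_eq_zero _).1 h f h0)

theorem evalAt_mem_of_mem_linForms {u : K} {E : IntermediateField F K} {n : ℕ}
    (hE : ∀ k < n, iterDeriv k u ∈ E) {f : DiffPoly Unit F} (hf : f ∈ linForms F n) :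
    evalAt (fun _ => u) f ∈ E := by
  have : linForms F n ≤ (Subalgebra.toSubmodule E.toSubalgebra).comap
      (aeval (fun v : Unit × ℕ => iterDeriv v.2 u) : DiffPoly Unit F →ₐ[F] K).toLinearMap := by
    refine Submodule.span_le.2 ?_
    rintro _ (rfl | ⟨k, hk, rfl⟩)
    · simp
    · simpa using hE k hk
  exact this hf

/-- If this vanished with a nonzero leading coefficient of q, then x would be a constant c, and
transcendence of u would give p = c q. Coprimality then makes q a constant, which has no leading
term. -/
theorem leading_ne_zero {u x : K} (hu : DiffTranscendental F u) {p q : DiffPoly Unit F} {n : ℕ}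
    (hpq : IsRelPrime p q)
    (hn : p.coeff (Finsupp.single ((), n) 1) ≠ 0 ∨ q.coeff (Finsupp.single ((), n) 1) ≠ 0)
    (hx : x * evalAt (fun _ => u) q = evalAt (fun _ => u) p) :
    x * algebraMap F K (q.coeff (Finsupp.single ((), n) 1)) -
      algebraMap F K (p.coeff (Finsupp.single ((), n) 1)) ≠ 0 := by
  intro h
  by_cases hqn : q.coeff (Finsupp.single ((), n) 1) = 0
  · rw [hqn, map_zero, mul_zero, zero_sub, neg_eq_zero, map_eq_zero] at h
    exact hn.elim (fun h' => h' h) fun h' => h' hqn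
  · set c := p.coeff (Finsupp.single ((), n) 1) / q.coeff (Finsupp.single ((), n) 1)
    have hxc : x = algebraMap F K c := by
      rw [map_div₀, eq_div_iff ((map_ne_zero _).2 hqn)]
      exact sub_eq_zero.1 h
    have hp : p = C c * q := by
      by_contra hne
      refine hu.evalAt_ne_zero (sub_ne_zero.2 hne) ?_
      unfold evalAt at hx ⊢
      rw [map_sub, map_mul, aeval_C, ← hx, hxc, sub_self]
    have hunit : IsUnit q := hpq (hp ▸ dvd_mul_left q (C c)) dvd_rfl
    obtain ⟨a, -, ha⟩ := isUnit_iff_eq_C_of_isReduced.1 hunit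
    apply hqn
    rw [ha, coeff_C, if_neg (Finsupp.single_ne_zero.2 (one_ne_zero' ℕ)).symm]

variable [Differential F]

theorem sum_antidiagonal_evalAt [DifferentialAlgebra F K] {u x : K} {p q : DiffPoly Unit F}
    (hx : x * evalAt (fun _ => u) q = evalAt (fun _ => u) p) (k : ℕ) :
    ∑ a ∈ Finset.HasAntidiagonal.antidiagonal k,
      k.choose a.1 • (iterDeriv a.1 x * evalAt (fun _ => u) (iterDeriv a.2 q)) =
        evalAt (fun _ => u) (iterDeriv k p) := by
  rw [evalAt_iterDeriv, ← hx, iterDeriv_mul]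
  simp only [evalAt_iterDeriv]

/-- The c-th derivative of x q(u) = p(u) is linear in u⁽ⁿ⁺ᶜ⁾ with the nonzero coefficient of
`leading_ne_zero`; all its other terms already lie in E. -/
theorem iterDeriv_mem_of_linear_fraction [DifferentialAlgebra F K] {u x : K}
    (hu : DiffTranscendental F u) {p q : DiffPoly Unit F} {n : ℕ} (hp : p ∈ linForms F (n + 1))
    (hq : q ∈ linForms F (n + 1)) (hpq : IsRelPrime p q)
    (hn : p.coeff (Finsupp.single ((), n) 1) ≠ 0 ∨ q.coeff (Finsupp.single ((), n) 1) ≠ 0)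
    (hx : x * evalAt (fun _ => u) q = evalAt (fun _ => u) p) {E : IntermediateField F K} {c : ℕ}
    (hE : ∀ k < n, iterDeriv k u ∈ E) (hxE : ∀ k < c, iterDeriv k x ∈ E) :
    ∀ k < n + c, iterDeriv k u ∈ E := by
  induction c with
  | zero => exact hE
  | succ c ih =>
    have ih' := ih fun k hk => hxE k (hk.trans (Nat.lt_succ_self c))
    intro k hk
    rcases (Nat.lt_succ_iff.1 (show k < n + c + 1 from hk)).lt_or_eq with h | rfl
    · exact ih' k h
    have h1 := leading_ne_zero hu hpq hn hx
    have h2 := sum_antidiagonal_evalAt hx c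
    -- Only the Leibniz term in which x is not differentiated can contain u⁽ⁿ⁺ᶜ⁾.
    rw [Finset.Nat.sum_antidiagonal_eq_sum_range_succ_mk, Finset.sum_range_succ'] at h2
    simp only [Nat.choose_zero_right, one_smul, iterDeriv_zero, Nat.sub_zero] at h2
    have h3 : ∑ k ∈ Finset.range c, c.choose (k + 1) • (iterDeriv (k + 1) x *
        evalAt (fun _ => u) (iterDeriv (c - (k + 1)) q)) ∈ E := by
      refine sum_mem fun k hk => nsmul_mem (mul_mem (hxE _ ?_) ?_) _
      · have := Finset.mem_range.1 hk
        omega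
      · refine evalAt_mem_of_mem_linForms ih' (linForms_mono ?_ (iterDeriv_mem_linForms hq _))
        have := Finset.mem_range.1 hk
        omega
    have hlead : ∀ f ∈ linForms F (n + 1), evalAt (fun _ => u) (iterDeriv c f) -
        algebraMap F K (f.coeff (Finsupp.single ((), n) 1)) * iterDeriv (n + c) u ∈ E := by
      intro f hf
      have := evalAt_mem_of_mem_linForms ih' (iterDeriv_sub_leading_mem_linForms hf c)
      unfold evalAt at this ⊢
      rwa [map_sub, map_mul, aeval_C, aeval_X] at this
    have h4 := sub_mem (hlead p hp) (mul_mem (hxE 0 (Nat.succ_pos c)) (hlead q hq))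
    have h5 := sub_mem h4 h3
    rw [← h2, iterDeriv_zero] at h5
    have h6 : (x * algebraMap F K (q.coeff (Finsupp.single ((), n) 1)) -
      algebraMap F K (p.coeff (Finsupp.single ((), n) 1))) * iterDeriv (n + c) u ∈ E := by
      convert h5 using 1
      ring
    have h7 : x * algebraMap F K (q.coeff (Finsupp.single ((), n) 1)) -
      algebraMap F K (p.coeff (Finsupp.single ((), n) 1)) ∈ E :=
      sub_mem (mul_mem (hxE 0 (Nat.succ_pos c)) (E.algebraMap_mem _)) (E.algebraMap_mem _)
    have h8 := mul_mem (inv_mem h7) h6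
    rwa [inv_mul_cancel_left₀ h1] at h8

end LinearFractions

/-! ### Properness bounds the orders of relations from below -/

section Freeness

variable {F K : Type*} [Field F] [Field K] [Algebra F K] [Differential K]

/-- The variables `zᵢ⁽ᵏ⁾`, `k < h`, and `zⱼ⁽ᵏ⁾`, `k < c`. -/
def blockVars {σ : Type*} (i j : σ) (h c : ℕ) : Set (σ × ℕ) :=
  {v | (v.1 = i ∧ v.2 < h) ∨ (v.1 = j ∧ v.2 < c)}

theorem finite_blockVars (i j : Fin 2) (h c : ℕ) : (blockVars i j h c).Finite := by
  refine (Set.finite_univ.prod (Set.finite_Iio (max h c))).subset ?_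
  rintro v (⟨-, h1⟩ | ⟨-, h1⟩)
  · exact ⟨trivial, lt_of_lt_of_le h1 (le_max_left _ _)⟩
  · exact ⟨trivial, lt_of_lt_of_le h1 (le_max_right _ _)⟩

theorem ncard_blockVars_le (i j : Fin 2) (h c : ℕ) : (blockVars i j h c).ncard ≤ h + c := by
  have : blockVars i j h c ⊆
      ↑((Finset.range h).image (fun k => (i, k)) ∪ (Finset.range c).image fun k => (j, k)) := by
    rintro ⟨a, k⟩ (⟨rfl, h1⟩ | ⟨rfl, h1⟩)
    · simp_all
    · simp_all
  refine (Set.ncard_le_ncard this (Finset.finite_toSet _)).trans ?_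
  rw [Set.ncard_coe_finset]
  refine (Finset.card_union_le _ _).trans (add_le_add ?_ ?_)
  · simpa using Finset.card_image_le (s := Finset.range h) (f := fun k => (i, k))
  · simpa using Finset.card_image_le (s := Finset.range c) (f := fun k => (j, k))

/-- The values of the variables at the point `η`. -/
def jetValue {σ : Type*} (η : σ → K) (v : σ × ℕ) : K :=
  iterDeriv v.2 (η v.1)

theorem evalAt_eq_aeval {σ : Type*} (η : σ → K) (f : DiffPoly σ F) :
    evalAt η f = aeval (jetValue η) f := by
  unfold evalAt
  rfl

theorem deriv_jetValue {σ : Type*} (η : σ → K) (v : σ × ℕ) :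
    Differential.deriv (jetValue η v) = jetValue η (v.1, v.2 + 1) :=
  (iterDeriv_succ _ _).symm

theorem jetValue_mem_algCl {σ : Type*} (η : σ → K) {S : Set (σ × ℕ)} {v : σ × ℕ} (hv : v ∈ S) :
    jetValue η v ∈ algCl F (jetValue η '' S) :=
  subset_algCl _ ⟨v, hv, rfl⟩

theorem algebraicIndepOn_blockVars {η : Fin 2 → K} {i j : Fin 2} {n : ℕ}
    (hsnd : ∀ c, jetValue η (j, c) ∉ algCl F (jetValue η '' blockVars i j 0 c))
    (hfst : ∀ h < n, ∀ c, jetValue η (i, h) ∉ algCl F (jetValue η '' blockVars i j h c))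
    (c h : ℕ) (hh : h ≤ n) : AlgebraicIndepOn F (jetValue η) (blockVars i j h c) := by
  have hinsert : ∀ {S : Set (Fin 2 × ℕ)} {v}, AlgebraicIndepOn F (jetValue η) S →
      jetValue η v ∉ algCl F (jetValue η '' S) →
      AlgebraicIndepOn F (jetValue η) (insert v S) := fun hS hv => hS.insert hv
  induction h with
  | zero =>
    induction c with
    | zero =>
      have : IsEmpty (blockVars i j 0 0) := ⟨fun v => v.2.elim (fun h => Nat.not_lt_zero _ h.2)
        fun h => Nat.not_lt_zero _ h.2⟩
      exact algebraicIndependent_empty_type_iff.2 (algebraMap F K).injective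
    | succ c ih =>
      have : blockVars i j 0 (c + 1) = insert (j, c) (blockVars i j 0 c) := by
        ext ⟨a, k⟩
        simp only [blockVars, Set.mem_ofPred_eq, Set.mem_insert_iff, Prod.mk.injEq]
        omega
      rw [this]
      exact hinsert ih (hsnd c)
  | succ h ih =>
    have : blockVars i j (h + 1) c = insert (i, h) (blockVars i j h c) := by
      ext ⟨a, k⟩
      simp only [blockVars, Set.mem_ofPred_eq, Set.mem_insert_iff, Prod.mk.injEq]
      omega
    rw [this]
    exact hinsert (ih (by omega)) (hfst h hh c)

variable [CharZero F] [Differential F] [DifferentialAlgebra F K]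

/-- The component ηⱼ is differentially transcendental. Otherwise all its derivatives are algebraic
over the first c of them, and together with u, …, u⁽ⁿ⁻¹⁾ these n + c elements would carry
transcendence degree n + c + 1. -/
theorem jetValue_snd_notMem_algCl {u : K} {η : Fin 2 → K} (i j : Fin 2) {n : ℕ}
    (hcard : ∀ (T : Set K) (c : ℕ), T.Finite → (∀ k < n, iterDeriv k u ∈ algCl F T) →
      (∀ k < c, iterDeriv k (η j) ∈ algCl F T) → n + c ≤ T.ncard) (c : ℕ) :
    jetValue η (j, c) ∉ algCl F (jetValue η '' blockVars i j 0 c) := by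
  intro hc
  have hcl : ∀ k, jetValue η (j, c + k) ∈ algCl F (jetValue η '' blockVars i j 0 c) := by
    intro k
    have := iterDeriv_mem_algCl (S := jetValue η '' blockVars i j 0 c) ?_ hc k
    · simpa only [jetValue, iterDeriv_iterDeriv, add_comm k c] using this
    · rintro _ ⟨⟨a, l⟩, (⟨-, hl⟩ | ⟨rfl, hl⟩), rfl⟩
      · exact absurd hl (Nat.not_lt_zero _)
      · rw [deriv_jetValue]
        rcases (Nat.succ_le_of_lt hl).eq_or_lt with h | h
        · subst h
          exact hc
        · exact jetValue_mem_algCl η (Or.inr ⟨rfl, h⟩)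
  have hall : ∀ k, jetValue η (j, k) ∈ algCl F (jetValue η '' blockVars i j 0 c) := by
    intro k
    rcases lt_or_ge k c with h | h
    · exact jetValue_mem_algCl η (Or.inr ⟨rfl, h⟩)
    · obtain ⟨l, rfl⟩ := Nat.exists_eq_add_of_le h
      exact hcl l
  let T : Set K := jetValue η '' blockVars i j 0 c ∪ (fun k => iterDeriv k u) '' Set.Iio n
  have hT : T.Finite := ((finite_blockVars i j 0 c).image _).union ((Set.finite_Iio n).image _)
  have h1 := hcard T (c + 1) hT (fun k hk => subset_algCl _ (Or.inr ⟨k, hk, rfl⟩))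
    fun k _ => algCl_mono Set.subset_union_left (hall k)
  have h2 : T.ncard ≤ c + n := by
    refine (Set.ncard_union_le _ _).trans (add_le_add ?_ ?_)
    · refine (Set.ncard_image_le (finite_blockVars i j 0 c)).trans ?_
      exact (ncard_blockVars_le i j 0 c).trans (Nat.zero_add c).le
    · refine (Set.ncard_image_le (Set.finite_Iio n)).trans ?_
      rw [← Finset.coe_Iio, Set.ncard_coe_finset, Nat.card_Iio]
  omega

/-- If ηᵢ⁽ʰ⁾ were algebraic over lower derivatives of ηᵢ and derivatives of ηⱼ, then, by properness,
u and its derivatives would be algebraic over h derivatives of ηᵢ and all derivatives of ηⱼ. For u,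
…, u⁽ⁿ⁻¹⁾ finitely many, say c′, derivatives of ηⱼ suffice, and the count n + c′ ≤ h + c′
contradicts h < n. -/
theorem jetValue_fst_notMem_algCl {u : K} {η : Fin 2 → K}
    (hprop : u ∈ diffAdjoin F (Set.range η)) {i j : Fin 2} (hij : i ≠ j) {n : ℕ}
    (hcard : ∀ (T : Set K) (c : ℕ), T.Finite → (∀ k < n, iterDeriv k u ∈ algCl F T) →
      (∀ k < c, iterDeriv k (η j) ∈ algCl F T) → n + c ≤ T.ncard) {h : ℕ} (hh : h < n) (c : ℕ) :
    jetValue η (i, h) ∉ algCl F (jetValue η '' blockVars i j h c) := by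
  intro hc
  -- With all derivatives of ηⱼ included, the algebraic closure of the values on S is stable under
  -- the derivation.
  let S : Set (Fin 2 × ℕ) := {v | (v.1 = i ∧ v.2 < h) ∨ v.1 = j}
  have hAS : ∀ c, blockVars i j h c ⊆ S := fun c v hv => hv.imp id fun h => h.1
  have hc' : jetValue η (i, h) ∈ algCl F (jetValue η '' S) :=
    algCl_mono (Set.image_mono (hAS c)) hc
  have hder : ∀ s ∈ jetValue η '' S, Differential.deriv s ∈ algCl F (jetValue η '' S) := by
    rintro _ ⟨⟨a, l⟩, (⟨rfl, hl⟩ | rfl), rfl⟩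
    · rw [deriv_jetValue]
      rcases (Nat.succ_le_of_lt hl).eq_or_lt with h' | h'
      · subst h'
        exact hc'
      · exact jetValue_mem_algCl η (Or.inl ⟨rfl, h'⟩)
    · rw [deriv_jetValue]
      exact jetValue_mem_algCl η (Or.inr rfl)
  have hη : ∀ a, η a ∈ algCl F (jetValue η '' S) := by
    intro a
    rcases eq_or_ne a j with rfl | ha
    · exact jetValue_mem_algCl (F := F) η (v := (a, 0)) (Or.inr rfl)
    · obtain rfl : a = i := by omega
      rcases Nat.eq_zero_or_pos h with rfl | hpos
      · exact hc'
      · exact jetValue_mem_algCl (F := F) η (v := (a, 0)) (Or.inl ⟨rfl, hpos⟩)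
  have huS : u ∈ algCl F (jetValue η '' S) := by
    refine (IntermediateField.adjoin_le_iff.2 ?_ : diffAdjoin F (Set.range η) ≤ _) hprop
    rintro _ ⟨_, ⟨a, rfl⟩, k, rfl⟩
    exact iterDeriv_mem_algCl hder (hη a) k
  have hmono : ∀ a b, a ≤ b → blockVars i j h a ⊆ blockVars i j h b := fun a b hab v hv =>
    hv.imp id fun h => ⟨h.1, lt_of_lt_of_le h.2 hab⟩
  have hufin : ∀ m, ∃ c, ∀ k < m, iterDeriv k u ∈ algCl F (jetValue η '' blockVars i j h c) := by
    intro m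
    induction m with
    | zero => exact ⟨0, fun k hk => absurd hk (Nat.not_lt_zero k)⟩
    | succ m ih =>
      obtain ⟨c, hc⟩ := ih
      obtain ⟨T, hTS, hT, hm⟩ := exists_finite_mem_algCl (iterDeriv_mem_algCl hder huS m)
      obtain ⟨T', hT'S, hT', rfl⟩ := Set.exists_subset_image_finite_and.1 ⟨T, hTS, hT, rfl⟩
      obtain ⟨c', hc'⟩ := (hT'.image Prod.snd).bddAbove
      have hsub : T' ⊆ blockVars i j h (c' + 1) := fun v hv =>
        (hT'S hv).imp id fun hj => ⟨hj, Nat.lt_succ_of_le (hc' ⟨v, hv, rfl⟩)⟩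
      refine ⟨max c (c' + 1), fun k hk => ?_⟩
      rcases (Nat.lt_succ_iff.1 hk).lt_or_eq with h | rfl
      · exact algCl_mono (Set.image_mono (hmono _ _ (le_max_left _ _))) (hc k h)
      · exact algCl_mono (Set.image_mono (hsub.trans (hmono _ _ (le_max_right _ _)))) hm
  obtain ⟨c', hc'⟩ := hufin n
  have h1 := hcard (jetValue η '' blockVars i j h c') c' ((finite_blockVars i j h c').image _) hc'
    fun k hk => jetValue_mem_algCl (F := F) η (v := (j, k)) (Or.inr ⟨rfl, hk⟩)
  have h2 := (Set.ncard_image_le (f := jetValue η) (finite_blockVars i j h c')).trans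
    (ncard_blockVars_le i j h c')
  omega

/-- The order bound in zᵢ is the order n of the other fraction: the derivatives of ηⱼ together with
n derivatives of ηᵢ are algebraically independent. -/
theorem eq_zero_of_evalAt_eq_zero {u : K} (hu : DiffTranscendental F u) {η : Fin 2 → K}
    (hprop : u ∈ diffAdjoin F (Set.range η)) {i j : Fin 2} (hij : i ≠ j) {p q : DiffPoly Unit F}
    {n : ℕ} (hp : p ∈ linForms F (n + 1)) (hq : q ∈ linForms F (n + 1)) (hpq : IsRelPrime p q)
    (hn : p.coeff (Finsupp.single ((), n) 1) ≠ 0 ∨ q.coeff (Finsupp.single ((), n) 1) ≠ 0)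
    (hx : η j * evalAt (fun _ => u) q = evalAt (fun _ => u) p) {f : DiffPoly (Fin 2) F}
    (hf : f ∈ supported F {v : Fin 2 × ℕ | v.1 = i → v.2 < n}) (h0 : evalAt η f = 0) : f = 0 := by
  -- A field containing u, …, u⁽ⁿ⁻¹⁾ and c derivatives of ηⱼ contains n + c derivatives of u, which
  -- are algebraically independent.
  have hcard : ∀ (T : Set K) (c : ℕ), T.Finite → (∀ k < n, iterDeriv k u ∈ algCl F T) →
      (∀ k < c, iterDeriv k (η j) ∈ algCl F T) → n + c ≤ T.ncard := by
    intro T c hT h1 h2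
    have := card_le_of_forall_mem_algCl (a := fun k : Fin (n + c) => iterDeriv (k : ℕ) u)
      (AlgebraicIndependent.comp hu _ Fin.val_injective) hT
      fun k => iterDeriv_mem_of_linear_fraction hu hp hq hpq hn hx h1 h2 k k.2
    simpa using this
  obtain ⟨c, hc⟩ := (f.vars.image Prod.snd).bddAbove
  have hfA : f ∈ supported F (blockVars i j n (c + 1)) := by
    refine mem_supported.2 fun v hv => ?_
    rcases eq_or_ne v.1 i with h | h
    · exact Or.inl ⟨h, mem_supported.1 hf hv h⟩
    · refine Or.inr ⟨by omega, Nat.lt_succ_of_le (hc ?_)⟩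
      exact Finset.mem_coe.2 (Finset.mem_image.2 ⟨v, hv, rfl⟩)
  rw [evalAt_eq_aeval] at h0
  exact (algebraicIndependent_comp_subtype (x := jetValue η)).1
    (algebraicIndepOn_blockVars (jetValue_snd_notMem_algCl i j hcard)
      (fun h hh c => jetValue_fst_notMem_algCl hprop hij hcard hh c) (c + 1) n le_rfl) f hfA h0

end Freeness

/-! ### Rows and entries of the resultant matrix -/

/-- The `r`-th row of the differential resultant matrix holds the coefficients of the `k`-th
derivative of the `i`-th polynomial, `(i, k) = rowIdx m₁ m₂ r`. -/
def rowIdx (m₁ m₂ : ℕ) (r : Fin (m₁ + m₂ + 2)) : Fin 2 × ℕ :=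
  if (r : ℕ) ≤ m₂ then (0, m₂ - r) else (1, m₁ + m₂ + 1 - r)

/-- The highest derivative of the `i`-th variable in the differential resultant matrix. -/
def topOrd (m₁ m₂ : ℕ) (i : Fin 2) : ℕ := if i = 0 then m₂ else m₁

/-- The row of the highest derivative of the `i`-th polynomial. -/
def topRow (m₁ m₂ : ℕ) (i : Fin 2) : Fin (m₁ + m₂ + 2) :=
  if i = 0 then 0 else ⟨m₂ + 1, by omega⟩

section Rows

variable (m₁ m₂ : ℕ)

theorem rowIdx_injective : Function.Injective (rowIdx m₁ m₂) := by
  intro r s h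
  unfold rowIdx at h
  split_ifs at h <;> simp only [Prod.mk.injEq] at h <;> ext <;> omega

theorem rowIdx_snd_le (r : Fin (m₁ + m₂ + 2)) :
    (rowIdx m₁ m₂ r).2 ≤ topOrd m₁ m₂ (rowIdx m₁ m₂ r).1 := by
  unfold rowIdx topOrd
  split_ifs <;> simp_all

theorem rowIdx_topRow (i : Fin 2) : rowIdx m₁ m₂ (topRow m₁ m₂ i) = (i, topOrd m₁ m₂ i) := by
  unfold rowIdx topRow topOrd
  fin_cases i <;> simp

theorem exists_rowIdx_eq {v : Fin 2 × ℕ} (hv : v.2 ≤ topOrd m₁ m₂ v.1) :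
    ∃ r, rowIdx m₁ m₂ r = v := by
  obtain ⟨i, k⟩ := v
  unfold topOrd at hv
  by_cases hi : i = 0
  · subst hi
    simp only [if_true] at hv
    exact ⟨⟨m₂ - k, by omega⟩, by simp [rowIdx]; omega⟩
  · obtain rfl : i = 1 := by omega
    simp only [if_neg hi] at hv
    refine ⟨⟨m₁ + m₂ + 1 - k, by omega⟩, ?_⟩
    rw [rowIdx, if_neg (by simp; omega)]
    simp
    omega

end Rows

theorem sum_map_C_coeff {F L : Type*} [Field F] [Field L] [Algebra F L] {N : ℕ} {σ : Type*}
    (φ : DiffPoly σ F →ₐ[F] L) (W : Fin (N + 2) → L) (f : DiffPoly Unit F) :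
    ∑ c, φ (C (f.coeff (colExp N c))) * W c = linEval F N W f := by
  rw [linEval_apply]
  refine Finset.sum_congr rfl fun c _ => ?_
  rw [← algebraMap_eq, φ.commutes]

section Entries

variable {F : Type*} [Field F] [Differential F] (P Q : Fin 2 → DiffPoly Unit F)

theorem coeff_iterDeriv_paramPoly (v : Fin 2 × ℕ) (e : Unit × ℕ →₀ ℕ) :
    (iterDeriv v.2 (paramPoly P Q v.1)).coeff e =
      ∑ p ∈ Finset.HasAntidiagonal.antidiagonal v.2, v.2.choose p.1 •
        (X (v.1, p.1) * C ((iterDeriv p.2 (Q v.1)).coeff e)) -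
      C ((iterDeriv v.2 (P v.1)).coeff e) := by
  rw [paramPoly, iterDeriv_sub, iterDeriv_mul, coeff_sub, coeff_sum, iterDeriv_map_C, coeff_map]
  refine congrArg (· - _) (Finset.sum_congr rfl fun p _ => ?_)
  rw [coeff_smul, iterDeriv_C, iterDeriv_map_C, coeff_C_mul, coeff_map, iterDeriv_X, zero_add]

/-- In the Leibniz expansion only the term that differentiates zᵢ alone reaches the variable v, and
its cofactor is Qᵢ undifferentiated. -/
theorem coeff_iterDeriv_paramPoly_eq_add (v : Fin 2 × ℕ) (e : Unit × ℕ →₀ ℕ) :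
    ∃ w ∈ supported F {v' : Fin 2 × ℕ | v'.1 = v.1 ∧ v'.2 < v.2},
      (iterDeriv v.2 (paramPoly P Q v.1)).coeff e = X v * C ((Q v.1).coeff e) + w := by
  rw [coeff_iterDeriv_paramPoly, Finset.Nat.sum_antidiagonal_eq_sum_range_succ_mk,
    Finset.sum_range_succ]
  simp only [Nat.choose_self, one_smul, Nat.sub_self, iterDeriv_zero]
  refine ⟨_, ?_, by rw [add_sub_right_comm, add_comm]⟩
  refine sub_mem (sum_mem fun k hk => ?_) (Subalgebra.algebraMap_mem _ _)
  refine nsmul_mem (mul_mem (X_mem_supported.2 ?_) (Subalgebra.algebraMap_mem _ _)) _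
  exact ⟨rfl, Finset.mem_range.1 hk⟩

theorem coeff_iterDeriv_paramPoly_mem_supported (v : Fin 2 × ℕ) (e : Unit × ℕ →₀ ℕ) :
    (iterDeriv v.2 (paramPoly P Q v.1)).coeff e ∈
      supported F {v' : Fin 2 × ℕ | v'.1 = v.1 ∧ v'.2 ≤ v.2} := by
  obtain ⟨w, hw, h⟩ := coeff_iterDeriv_paramPoly_eq_add P Q v e
  rw [h]
  refine add_mem (mul_mem (X_mem_supported.2 ⟨rfl, le_rfl⟩) (Subalgebra.algebraMap_mem _ _)) ?_
  refine supported_mono ?_ hw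
  rintro v' ⟨h1, h2⟩
  exact ⟨h1, h2.le⟩

theorem pderiv_coeff_iterDeriv_paramPoly (v : Fin 2 × ℕ) (e : Unit × ℕ →₀ ℕ) :
    pderiv v ((iterDeriv v.2 (paramPoly P Q v.1)).coeff e) = C ((Q v.1).coeff e) := by
  obtain ⟨w, hw, h⟩ := coeff_iterDeriv_paramPoly_eq_add P Q v e
  rw [h, map_add, pderiv_eq_zero_of_mem_supported hw fun h => lt_irrefl _ h.2, Derivation.leibniz,
    pderiv_C, pderiv_X_self]
  simp

theorem pderiv_coeff_iterDeriv_paramPoly_eq_zero {v v' : Fin 2 × ℕ} (e : Unit × ℕ →₀ ℕ)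
    (h : v.1 = v'.1 → v'.2 < v.2) :
    pderiv v ((iterDeriv v'.2 (paramPoly P Q v'.1)).coeff e) = 0 :=
  pderiv_eq_zero_of_mem_supported (coeff_iterDeriv_paramPoly_mem_supported P Q v' e)
    fun h' => absurd h'.2 (not_le.2 (h h'.1))

/-- The differential resultant matrix of the polynomials `x Q₀(u) - P₀(u)` and
`y Q₁(u) - P₁(u)`. -/
noncomputable def paramMatrix (m₁ m₂ : ℕ) :
    Matrix (Fin (m₁ + m₂ + 2)) (Fin (m₁ + m₂ + 2)) (DiffPoly (Fin 2) F) :=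
  diffResMatrix (paramPoly P Q 0) (paramPoly P Q 1) m₁ m₂

variable {m₁ m₂ : ℕ}

theorem paramMatrix_apply (r c : Fin (m₁ + m₂ + 2)) :
    paramMatrix P Q m₁ m₂ r c = (iterDeriv (rowIdx m₁ m₂ r).2
      (paramPoly P Q (rowIdx m₁ m₂ r).1)).coeff (colExp (m₁ + m₂) c) := by
  rw [paramMatrix, diffResMatrix, Matrix.of_apply, rowIdx, colExp]
  split_ifs <;> rfl

theorem sum_map_paramMatrix {L : Type*} [Field L] [Algebra F L] (φ : DiffPoly (Fin 2) F →ₐ[F] L)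
    (W : Fin (m₁ + m₂ + 2) → L) (r : Fin (m₁ + m₂ + 2)) :
    ∑ c, φ (paramMatrix P Q m₁ m₂ r c) * W c =
      ∑ p ∈ Finset.HasAntidiagonal.antidiagonal (rowIdx m₁ m₂ r).2,
        (rowIdx m₁ m₂ r).2.choose p.1 • (φ (X ((rowIdx m₁ m₂ r).1, p.1)) *
          linEval F (m₁ + m₂) W (iterDeriv p.2 (Q (rowIdx m₁ m₂ r).1))) -
      linEval F (m₁ + m₂) W (iterDeriv (rowIdx m₁ m₂ r).2 (P (rowIdx m₁ m₂ r).1)) := by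
  simp only [paramMatrix_apply, coeff_iterDeriv_paramPoly, map_sub, sub_mul,
    Finset.sum_sub_distrib, map_sum, Finset.sum_mul, linEval_apply]
  congr 1
  · rw [Finset.sum_comm]
    refine Finset.sum_congr rfl fun p _ => ?_
    rw [Finset.mul_sum, Finset.smul_sum]
    refine Finset.sum_congr rfl fun c _ => ?_
    rw [map_nsmul, map_mul, ← algebraMap_eq, φ.commutes, smul_mul_assoc, mul_assoc]
  · refine Finset.sum_congr rfl fun c _ => ?_
    rw [← algebraMap_eq, φ.commutes]

end Entries

/-! ### Cramer's rule and left kernels -/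

section Determinants

theorem Matrix.det_mem_subalgebra {R A n : Type*} [CommRing R] [CommRing A] [Algebra R A]
    [Fintype n] [DecidableEq n] {S : Subalgebra R A} {B : Matrix n n A} (hB : ∀ r c, B r c ∈ S) :
    B.det ∈ S := by
  rw [Matrix.det_apply]
  exact sum_mem fun τ _ => zsmul_mem (prod_mem fun i _ => hB _ _) _

theorem Matrix.map_det_mul {R L n : Type*} [CommRing R] [CommRing L] [Fintype n] [DecidableEq n]
    (φ : R →+* L) (B : Matrix n n R) (W : n → L) (c : n) :
    φ B.det * W c = ∑ r, φ (B.adjugate c r) * ∑ c', φ (B r c') * W c' := by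
  have h : ∀ c', φ (∑ r, B.adjugate c r * B r c') = if c = c' then φ B.det else 0 := by
    intro c'
    have := congrFun (congrFun B.adjugate_mul c) c'
    rw [Matrix.mul_apply] at this
    rw [this, Matrix.smul_apply, Matrix.one_apply]
    split_ifs <;> simp
  have h' : φ B.det * W c = ∑ c', φ (∑ r, B.adjugate c r * B r c') * W c' := by
    simp only [h, ite_mul, zero_mul, Finset.sum_ite_eq, Finset.mem_univ, if_true]
  rw [h']
  simp only [map_sum, map_mul, Finset.sum_mul, Finset.mul_sum]
  rw [Finset.sum_comm]
  simp only [mul_assoc]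

/-- Keeping the kernel vector inside S matters: its entries then involve few variables, so that
vanishing at η forces them to be zero. -/
theorem exists_vecMul_eq_zero_of_mem_subalgebra {R A n : Type*} [CommRing R] [CommRing A] [IsDomain A]
    [Algebra R A] [Fintype n] [DecidableEq n] {S : Subalgebra R A} {B : Matrix n n A}
    (hB : ∀ r c, B r c ∈ S) (hdet : B.det = 0) :
    ∃ v : n → A, v ≠ 0 ∧ (∀ r, v r ∈ S) ∧ ∀ c, ∑ r, v r * B r c = 0 := by
  let B' : Matrix n n S := Matrix.of fun r c => ⟨B r c, hB r c⟩
  have hB' : S.val.mapMatrix B' = B := by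
    ext r c
    rfl
  have hdet' : B'.det = 0 := by
    refine Subtype.val_injective ?_
    change S.val B'.det = 0
    rw [AlgHom.map_det, hB', hdet]
  obtain ⟨v, hv, h⟩ := Matrix.exists_vecMul_eq_zero_iff.2 hdet'
  refine ⟨fun r => v r, fun h0 => hv (funext fun r => Subtype.ext (congrFun h0 r)),
    fun r => (v r).2, fun c => ?_⟩
  have := congrArg Subtype.val (congrFun h c)
  rw [Matrix.vecMul, dotProduct] at this
  simpa [B'] using this

/-- A left kernel relation is differentiated in one variable and paired with W. For rows that W
annihilates, the second summand drops out. -/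
theorem sum_pderiv_mul_eq_zero {τ F L n : Type*} [Field F] [CommRing L] [Fintype n]
    (φ : MvPolynomial τ F →+* L) {v : n → MvPolynomial τ F} {B : Matrix n n (MvPolynomial τ F)}
    (h : ∀ c, ∑ r, v r * B r c = 0) (W : n → L) (x : τ) :
    ∑ r, (φ (v r) * ∑ c, φ (pderiv x (B r c)) * W c +
      φ (pderiv x (v r)) * ∑ c, φ (B r c) * W c) = 0 := by
  have h' : ∑ c, φ (pderiv x (∑ r, v r * B r c)) * W c = 0 := by
    refine Finset.sum_eq_zero fun c _ => ?_
    rw [h, map_zero, map_zero, zero_mul]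
  simp only [map_sum, Derivation.leibniz, smul_eq_mul, map_add, map_mul, Finset.sum_mul] at h'
  rw [Finset.sum_comm] at h'
  rw [← h']
  refine Finset.sum_congr rfl fun r _ => ?_
  rw [Finset.mul_sum, Finset.mul_sum, ← Finset.sum_add_distrib]
  refine Finset.sum_congr rfl fun c _ => ?_
  ring

end Determinants

/-! ### The resultant as a linear polynomial in each highest derivative -/

/-- `p / q` is a reduced fraction of differential polynomials of degree at most one, of order
`n`. -/
structure IsLinFrac {F : Type*} [Field F] (p q : DiffPoly Unit F) (n : ℕ) : Prop where
  num_mem : p ∈ linForms F (n + 1)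
  den_mem : q ∈ linForms F (n + 1)
  den_ne_zero : q ≠ 0
  relPrime : IsRelPrime p q
  leading : p.coeff (Finsupp.single ((), n) 1) ≠ 0 ∨ q.coeff (Finsupp.single ((), n) 1) ≠ 0

theorem add_topOrd (m : Fin 2 → ℕ) (i : Fin 2) : m i + topOrd (m 0) (m 1) i = m 0 + m 1 := by
  unfold topOrd
  fin_cases i <;> simp [add_comm]

theorem rowIdx_zero_of_ne {m₁ m₂ : ℕ} {i : Fin 2} {r : Fin (m₁ + m₂ + 2)}
    (hr : r ≠ topRow m₁ m₂ i) (hi : (rowIdx m₁ m₂ r).1 = i) :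
    (rowIdx m₁ m₂ r).2 < topOrd m₁ m₂ i := by
  refine lt_of_le_of_ne (hi ▸ rowIdx_snd_le m₁ m₂ r) fun h => hr ?_
  exact rowIdx_injective m₁ m₂ (by rw [rowIdx_topRow]; exact Prod.ext hi h)

/-- The variables that occur in the differential resultant matrix. -/
def boxVars (m₁ m₂ : ℕ) : Set (Fin 2 × ℕ) := {v | v.2 ≤ topOrd m₁ m₂ v.1}

/-- The variables that occur in the rows of the matrix other than `topRow i`. -/
def cutVars (m₁ m₂ : ℕ) (i : Fin 2) : Set (Fin 2 × ℕ) :=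
  {v | v.2 ≤ topOrd m₁ m₂ v.1 ∧ (v.1 = i → v.2 < topOrd m₁ m₂ i)}

section Resultant

variable {F : Type*} [Field F] [Differential F] (P Q : Fin 2 → DiffPoly Unit F) (m₁ m₂ : ℕ)

/-- The coefficient of the highest derivative of the `i`-th variable in the resultant. -/
noncomputable def topCoeff (i : Fin 2) : DiffPoly (Fin 2) F :=
  ((paramMatrix P Q m₁ m₂).updateRow (topRow m₁ m₂ i)
    fun c => C ((Q i).coeff (colExp (m₁ + m₂) c))).det

theorem paramMatrix_mem_supported_cutVars (i : Fin 2) {r : Fin (m₁ + m₂ + 2)}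
    (hr : r ≠ topRow m₁ m₂ i) (c : Fin (m₁ + m₂ + 2)) :
    paramMatrix P Q m₁ m₂ r c ∈ supported F (cutVars m₁ m₂ i) := by
  rw [paramMatrix_apply]
  refine supported_mono ?_ (coeff_iterDeriv_paramPoly_mem_supported P Q _ _)
  rintro v ⟨h1, h2⟩
  refine ⟨h1 ▸ h2.trans (rowIdx_snd_le m₁ m₂ r), fun h => ?_⟩
  exact lt_of_le_of_lt h2 (rowIdx_zero_of_ne hr (h1 ▸ h))

theorem updateRow_mem_supported_cutVars (i : Fin 2) {w : Fin (m₁ + m₂ + 2) → DiffPoly (Fin 2) F}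
    (hw : ∀ c, w c ∈ supported F (cutVars m₁ m₂ i)) (r c : Fin (m₁ + m₂ + 2)) :
    (paramMatrix P Q m₁ m₂).updateRow (topRow m₁ m₂ i) w r c ∈ supported F (cutVars m₁ m₂ i) := by
  rcases eq_or_ne r (topRow m₁ m₂ i) with rfl | hr
  · rw [Matrix.updateRow_self]
    exact hw c
  · rw [Matrix.updateRow_ne hr]
    exact paramMatrix_mem_supported_cutVars P Q m₁ m₂ i hr c

theorem topCoeff_mem_supported (i : Fin 2) :
    topCoeff P Q m₁ m₂ i ∈ supported F (cutVars m₁ m₂ i) :=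
  Matrix.det_mem_subalgebra
    (updateRow_mem_supported_cutVars P Q m₁ m₂ i fun _ => Subalgebra.algebraMap_mem _ _)

/-- The highest derivative of zᵢ occurs in one row only; the determinant is split along that row. -/
theorem det_paramMatrix_eq_add (i : Fin 2) :
    ∃ T ∈ supported F (cutVars m₁ m₂ i),
      (paramMatrix P Q m₁ m₂).det =
        X (i, topOrd m₁ m₂ i) * topCoeff P Q m₁ m₂ i + T := by
  choose w hw h using fun c => coeff_iterDeriv_paramPoly_eq_add P Q (i, topOrd m₁ m₂ i)
    (colExp (m₁ + m₂) c)
  refine ⟨((paramMatrix P Q m₁ m₂).updateRow (topRow m₁ m₂ i) w).det,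
    Matrix.det_mem_subalgebra (updateRow_mem_supported_cutVars P Q m₁ m₂ i fun c => ?_), ?_⟩
  · refine supported_mono ?_ (hw c)
    rintro v ⟨h1, h2⟩
    have h1' : v.1 = i := h1
    exact ⟨h1' ▸ h2.le, fun _ => h2⟩
  · have hrow : paramMatrix P Q m₁ m₂ (topRow m₁ m₂ i) =
        (X (i, topOrd m₁ m₂ i) : DiffPoly (Fin 2) F) •
          (fun c => (C ((Q i).coeff (colExp (m₁ + m₂) c)) : DiffPoly (Fin 2) F)) + w := by
      ext1 c
      rw [paramMatrix_apply, rowIdx_topRow, h c]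
      rfl
    conv_lhs => rw [← Matrix.updateRow_eq_self (paramMatrix P Q m₁ m₂) (topRow m₁ m₂ i), hrow]
    rw [Matrix.det_updateRow_add, Matrix.det_updateRow_smul, topCoeff]

theorem det_paramMatrix_mem_supported :
    (paramMatrix P Q m₁ m₂).det ∈ supported F (boxVars m₁ m₂) := by
  obtain ⟨T, hT, h⟩ := det_paramMatrix_eq_add P Q m₁ m₂ 0
  have hle : supported F (cutVars m₁ m₂ 0) ≤ supported F (boxVars m₁ m₂) :=
    supported_mono fun v hv => hv.1
  rw [h]
  exact add_mem (mul_mem (X_mem_supported.2 (Set.mem_ofPred.2 le_rfl))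
    (hle (topCoeff_mem_supported P Q m₁ m₂ 0))) (hle hT)

end Resultant

/-! ### The resultant matrix at the generic point -/

section Proper

variable {F K : Type*} [Field F] [Field K] [Algebra F K] [Differential K] {u : K}
  {P Q : Fin 2 → DiffPoly Unit F} {m : Fin 2 → ℕ}

theorem paramPoint_mul (hu : DiffTranscendental F u) (h : ∀ i, IsLinFrac (P i) (Q i) (m i))
    (i : Fin 2) :
    paramPoint u P Q i * evalAt (fun _ => u) (Q i) = evalAt (fun _ => u) (P i) :=
  div_mul_cancel₀ _ (hu.evalAt_ne_zero (h i).den_ne_zero)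

theorem aeval_jetValue_mem_diffAdjoin {σ : Type*} (η : σ → K) (f : DiffPoly σ F) :
    aeval (jetValue η) f ∈ diffAdjoin F (Set.range η) := by
  induction f using MvPolynomial.induction_on with
  | C a => rw [aeval_C]; exact (diffAdjoin F (Set.range η)).algebraMap_mem a
  | add p q hp hq => rw [map_add]; exact add_mem hp hq
  | mul_X p v hp =>
    rw [map_mul, aeval_X]
    exact mul_mem hp (IntermediateField.subset_adjoin _ _ ⟨_, ⟨v.1, rfl⟩, v.2, rfl⟩)

theorem evalAt_mem_diffAdjoin {S : Set K} {a : K} (ha : a ∈ S) (f : DiffPoly Unit F) :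
    evalAt (fun _ => a) f ∈ diffAdjoin F S := by
  rw [evalAt_eq_aeval]
  refine IntermediateField.adjoin.mono F _ _ ?_ (aeval_jetValue_mem_diffAdjoin (fun _ => a) f)
  rintro _ ⟨_, ⟨_, rfl⟩, k, rfl⟩
  exact ⟨a, ha, k, rfl⟩

variable [Differential F] [DifferentialAlgebra F K]

theorem iterDeriv_mem_linForms_of_le {f : DiffPoly Unit F} {i : Fin 2}
    (hf : f ∈ linForms F (m i + 1)) {k : ℕ} (hk : k ≤ topOrd (m 0) (m 1) i) :
    iterDeriv k f ∈ linForms F (m 0 + m 1 + 1) := by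
  refine linForms_mono ?_ (iterDeriv_mem_linForms hf k)
  have := add_topOrd m i
  omega

theorem sum_paramMatrix_mul_jetVec (hu : DiffTranscendental F u)
    (h : ∀ i, IsLinFrac (P i) (Q i) (m i)) (r : Fin (m 0 + m 1 + 2)) :
    ∑ c, aeval (jetValue (paramPoint u P Q)) (paramMatrix P Q (m 0) (m 1) r c) *
      jetVec (m 0 + m 1) (fun k => iterDeriv k u) c = 0 := by
  have hr := rowIdx_snd_le (m 0) (m 1) r
  rw [sum_map_paramMatrix, sub_eq_zero, linEval_jetVec_evalAt u
    (iterDeriv_mem_linForms_of_le (h _).num_mem hr),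
    ← sum_antidiagonal_evalAt (paramPoint_mul hu h _)]
  refine Finset.sum_congr rfl fun p hp => ?_
  rw [Finset.HasAntidiagonal.mem_antidiagonal] at hp
  rw [linEval_jetVec_evalAt u (iterDeriv_mem_linForms_of_le (h _).den_mem (by omega)), aeval_X]
  rfl

theorem deriv_mem_diffAdjoin {S : Set K} {a : K} (ha : a ∈ diffAdjoin F S) :
    Differential.deriv a ∈ diffAdjoin F S := by
  unfold diffAdjoin at ha ⊢
  induction ha using IntermediateField.adjoin_induction with
  | mem x hx =>
    obtain ⟨b, hb, k, rfl⟩ := hx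
    rw [← iterDeriv_succ]
    exact IntermediateField.subset_adjoin _ _ ⟨b, hb, k + 1, rfl⟩
  | algebraMap x =>
    rw [DifferentialAlgebra.deriv_algebraMap]
    exact IntermediateField.algebraMap_mem _ _
  | add x y _ _ hx hy => rw [map_add]; exact add_mem hx hy
  | mul x y hx hy hx' hy' =>
    rw [Derivation.leibniz]
    exact add_mem (mul_mem hx hy') (mul_mem hy hx')
  | inv x hx hx' =>
    rw [Derivation.leibniz_inv]
    exact mul_mem (neg_mem (pow_mem (inv_mem hx) 2)) hx'

theorem iterDeriv_mem_diffAdjoin {S : Set K} {a : K} (ha : a ∈ diffAdjoin F S) (k : ℕ) :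
    iterDeriv k a ∈ diffAdjoin F S := by
  induction k with
  | zero => exact ha
  | succ k ih => rw [iterDeriv_succ]; exact deriv_mem_diffAdjoin ih

theorem isProperParam_iff : IsProperParam u P Q ↔
    u ∈ diffAdjoin F (Set.range (paramPoint u P Q)) := by
  constructor
  · intro h
    rw [h]
    exact IntermediateField.subset_adjoin _ _ ⟨u, rfl, 0, rfl⟩
  · intro h
    refine le_antisymm (IntermediateField.adjoin_le_iff.2 ?_) (IntermediateField.adjoin_le_iff.2 ?_)
    · rintro _ ⟨_, ⟨i, rfl⟩, k, rfl⟩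
      refine iterDeriv_mem_diffAdjoin (div_mem ?_ ?_) k
      · exact evalAt_mem_diffAdjoin (Set.mem_singleton u) (P i)
      · exact evalAt_mem_diffAdjoin (Set.mem_singleton u) (Q i)
    · rintro _ ⟨_, rfl, k, rfl⟩
      exact iterDeriv_mem_diffAdjoin h k

/-- The matrix defining `topCoeff` sends the jet of u to Q₀(u) times a unit vector. By Cramer's rule
the column of 1 puts Q₀(u) into the field generated by the point, and the column of u then does the
same for u. -/
theorem isProperParam_of_topCoeff_ne_zero (hu : DiffTranscendental F u)
    (h : ∀ i, IsLinFrac (P i) (Q i) (m i))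
    (h0 : aeval (jetValue (paramPoint u P Q)) (topCoeff P Q (m 0) (m 1) 0) ≠ 0) :
    IsProperParam u P Q := by
  set φ := (aeval (jetValue (paramPoint u P Q)) : DiffPoly (Fin 2) F →ₐ[F] K) with hφ
  set W := jetVec (m 0 + m 1) (fun k => iterDeriv k u) with hW
  rw [isProperParam_iff]
  set G := diffAdjoin F (Set.range (paramPoint u P Q)) with hG
  have hφG : ∀ f, φ f ∈ G := aeval_jetValue_mem_diffAdjoin _
  set B := (paramMatrix P Q (m 0) (m 1)).updateRow (topRow (m 0) (m 1) 0)
    (fun c => C ((Q 0).coeff (colExp (m 0 + m 1) c))) with hB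
  have hrow : ∀ c, φ (topCoeff P Q (m 0) (m 1) 0) * W c =
      φ (B.adjugate c (topRow (m 0) (m 1) 0)) * evalAt (fun _ => u) (Q 0) := by
    intro c
    rw [topCoeff, ← hB]
    refine (Matrix.map_det_mul (φ : DiffPoly (Fin 2) F →+* K) B W c).trans ?_
    rw [Finset.sum_eq_single (topRow (m 0) (m 1) 0)]
    · simp only [hB, Matrix.updateRow_self, RingHom.coe_coe]
      rw [sum_map_C_coeff, linEval_jetVec_evalAt]
      exact iterDeriv_mem_linForms_of_le (k := 0) (h 0).den_mem (Nat.zero_le _)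
    · intro r _ hr
      simp only [hB, Matrix.updateRow_ne hr, RingHom.coe_coe]
      rw [sum_paramMatrix_mul_jetVec hu h, mul_zero]
    · simp
  have hQ : evalAt (fun _ => u) (Q 0) ∈ G := by
    have h1 := hrow (Fin.last _)
    have h2 : W (Fin.last _) = 1 := by simp [hW, jetVec]
    rw [h2, mul_one] at h1
    have h3 : φ (B.adjugate (Fin.last _) (topRow (m 0) (m 1) 0)) ≠ 0 := by
      intro h3
      rw [h3, zero_mul] at h1
      exact h0 h1
    have h4 := mul_mem (inv_mem (hφG (B.adjugate (Fin.last _) (topRow (m 0) (m 1) 0))))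
      (hφG (topCoeff P Q (m 0) (m 1) 0))
    rwa [h1, inv_mul_cancel_left₀ h3] at h4
  have h1 := hrow ⟨m 0 + m 1, by omega⟩
  have h2 : W ⟨m 0 + m 1, by omega⟩ = u := by simp [hW, jetVec]
  rw [h2] at h1
  have h3 := mul_mem (inv_mem (hφG (topCoeff P Q (m 0) (m 1) 0)))
    (mul_mem (hφG (B.adjugate ⟨m 0 + m 1, by omega⟩ (topRow (m 0) (m 1) 0))) hQ)
  rwa [← h1, inv_mul_cancel_left₀ h0] at h3

/-- If det M = 0, the last row of the adjugate is a left kernel vector. Differentiating it in the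
highest derivative of x and pairing with the jet isolates one cofactor times Q₀(u), so it suffices
that this cofactor is nonzero at η. -/
theorem det_paramMatrix_ne_zero (hu : DiffTranscendental F u)
    (h : ∀ i, IsLinFrac (P i) (Q i) (m i))
    (hfree : ∀ f ∈ supported F (cutVars (m 0) (m 1) 0),
      aeval (jetValue (paramPoint u P Q)) f = 0 → f = 0) :
    (paramMatrix P Q (m 0) (m 1)).det ≠ 0 := by
  classical
  set φ := (aeval (jetValue (paramPoint u P Q)) : DiffPoly (Fin 2) F →ₐ[F] K) with hφ
  set W := jetVec (m 0 + m 1) (fun k => iterDeriv k u) with hW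
  set M := paramMatrix P Q (m 0) (m 1) with hM
  set r₀ := topRow (m 0) (m 1) 0 with hr₀
  have hW1 : W (Fin.last _) = 1 := by simp [hW, jetVec]
  have hker : ∀ r, ∑ c, φ (M r c) * W c = 0 := sum_paramMatrix_mul_jetVec hu h
  have hQ : ∀ i, ∑ c, φ (C ((Q i).coeff (colExp (m 0 + m 1) c))) * W c ≠ 0 := by
    intro i
    rw [sum_map_C_coeff, linEval_jetVec_evalAt]
    · exact hu.evalAt_ne_zero (h i).den_ne_zero
    · exact iterDeriv_mem_linForms_of_le (k := 0) (h i).den_mem (Nat.zero_le _)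
  have hpd : ∀ r c, pderiv (rowIdx (m 0) (m 1) r) (M r c) =
      C ((Q (rowIdx (m 0) (m 1) r).1).coeff (colExp (m 0 + m 1) c)) := by
    intro r c
    rw [hM, paramMatrix_apply, pderiv_coeff_iterDeriv_paramPoly]
  have hadj : φ (M.adjugate (Fin.last _) r₀) ≠ 0 := by
    rw [Matrix.adjugate_apply]
    -- The cofactor is det B, and the entries of B avoid the highest derivative of x, so vanishing
    -- at η would make det B the zero polynomial.
    set B := M.updateRow r₀ (Pi.single (Fin.last _) 1) with hB
    have hBmem : ∀ r c, B r c ∈ supported F (cutVars (m 0) (m 1) 0) := by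
      refine updateRow_mem_supported_cutVars P Q (m 0) (m 1) 0 fun c => ?_
      rw [Pi.single_apply]
      split_ifs
      · exact one_mem _
      · exact zero_mem _
    intro hdet
    have hdet' := hfree _ (Matrix.det_mem_subalgebra hBmem) hdet
    obtain ⟨v, hv, hvmem, hvB⟩ := exists_vecMul_eq_zero_of_mem_subalgebra hBmem hdet'
    have hBW : ∀ r, ∑ c, φ (B r c) * W c = if r = r₀ then 1 else 0 := by
      intro r
      split_ifs with hr
      · rw [hr, hB, Matrix.updateRow_self, Finset.sum_eq_single (Fin.last _)]
        · rw [Pi.single_eq_same, map_one, one_mul, hW1]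
        · intro c _ hc
          rw [Pi.single_eq_of_ne hc, map_zero, zero_mul]
        · simp
      · rw [hB]
        simp only [Matrix.updateRow_ne hr]
        exact hker r
    -- B maps the jet W to the unit vector at r₀, so pairing vB = 0 with W leaves only v r₀.
    have hv0 : v r₀ = 0 := by
      refine hfree _ (hvmem r₀) ?_
      have : ∑ r, φ (v r) * ∑ c, φ (B r c) * W c = 0 := by
        simp only [Finset.mul_sum, ← mul_assoc, ← map_mul]
        rw [Finset.sum_comm]
        simp only [← Finset.sum_mul, ← map_sum, hvB, map_zero, zero_mul, Finset.sum_const_zero]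
      simpa [hBW] using this
    -- Among the rows with v r ≠ 0, one of maximal derivation order r₁ is the only one that contains
    -- the variable of r₁. Differentiating vB = 0 in it yields v r₁ · Qᵢ(u) = 0 at η.
    obtain ⟨r₁, hr₁, hmax⟩ := Finset.exists_max_image (Finset.univ.filter fun r => v r ≠ 0)
      (fun r => (rowIdx (m 0) (m 1) r).2)
      (by obtain ⟨r, hr⟩ := Function.ne_iff.1 hv; exact ⟨r, by simpa using hr⟩)
    rw [Finset.mem_filter] at hr₁
    have hr₁₀ : r₁ ≠ r₀ := fun h' => hr₁.2 (h' ▸ hv0)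
    have hd := sum_pderiv_mul_eq_zero (φ : DiffPoly (Fin 2) F →+* K) hvB W (rowIdx (m 0) (m 1) r₁)
    simp only [RingHom.coe_coe] at hd
    rw [Finset.sum_eq_single r₁] at hd
    · rw [hBW, if_neg hr₁₀, mul_zero, add_zero, hB] at hd
      simp only [Matrix.updateRow_ne hr₁₀, hpd] at hd
      exact hr₁.2 (hfree _ (hvmem r₁) ((mul_eq_zero.1 hd).resolve_right (hQ _)))
    · intro r _ hr
      rcases eq_or_ne r r₀ with rfl | hrr
      · rw [hv0, map_zero, map_zero, map_zero, zero_mul, zero_mul, add_zero]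
      · rw [hBW, if_neg hrr, mul_zero, add_zero]
        by_cases hvr : v r = 0
        · rw [hvr, map_zero, zero_mul]
        · have hle := hmax r (Finset.mem_filter.2 ⟨Finset.mem_univ _, hvr⟩)
          rw [hB]
          simp only [Matrix.updateRow_ne hrr]
          rw [Finset.sum_eq_zero, mul_zero]
          intro c _
          rw [hM, paramMatrix_apply, pderiv_coeff_iterDeriv_paramPoly_eq_zero, map_zero, zero_mul]
          intro h1
          exact lt_of_le_of_ne hle fun h2 => hr (rowIdx_injective _ _ (Prod.ext h1.symm h2))
    · simp
  intro hR
  have hrel : ∀ c, ∑ r, M.adjugate (Fin.last _) r * M r c = 0 := by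
    intro c
    have := congrFun (congrFun M.adjugate_mul (Fin.last _)) c
    rw [Matrix.mul_apply] at this
    rw [this, hR, zero_smul, Matrix.zero_apply]
  have hd := sum_pderiv_mul_eq_zero (φ : DiffPoly (Fin 2) F →+* K) hrel W (rowIdx (m 0) (m 1) r₀)
  simp only [RingHom.coe_coe] at hd
  rw [Finset.sum_eq_single r₀] at hd
  · rw [hker, mul_zero, add_zero] at hd
    simp only [hpd] at hd
    exact (mul_ne_zero hadj (hQ _)) hd
  · intro r _ hr
    rw [hker, mul_zero, add_zero, Finset.sum_eq_zero, mul_zero]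
    intro c _
    rw [hM, paramMatrix_apply, pderiv_coeff_iterDeriv_paramPoly_eq_zero, map_zero, zero_mul]
    rw [hr₀, rowIdx_topRow]
    exact fun h1 => rowIdx_zero_of_ne hr h1.symm
  · simp

end Proper

/-! ### Linear relations among the entries of a vector -/

section Dimension

variable {F L : Type*} [Field F] [Field L] [Algebra F L] {N : ℕ}

theorem exists_leading_of_mem_linForms {f : DiffPoly Unit F} {n : ℕ} (hf : f ∈ linForms F n)
    (h0 : f ≠ 0) : (∃ a, a ≠ 0 ∧ f = C a) ∨
      ∃ k < n, f ∈ linForms F (k + 1) ∧ f.coeff (Finsupp.single ((), k) 1) ≠ 0 := by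
  induction n with
  | zero =>
    rw [linForms, show Set.Iio 0 = ∅ by ext; simp, Set.image_empty, insert_empty_eq, Submodule.mem_span_singleton] at hf
    obtain ⟨a, rfl⟩ := hf
    rw [smul_eq_C_mul, mul_one] at h0 ⊢
    exact Or.inl ⟨a, fun h => h0 (by rw [h, C_0]), rfl⟩
  | succ n ih =>
    by_cases hn : f.coeff (Finsupp.single ((), n) 1) = 0
    · have := sub_leading_mem_linForms hf
      rw [hn, C_0, zero_mul, sub_zero] at this
      exact (ih this).imp id fun ⟨k, hk, h⟩ => ⟨k, hk.trans (Nat.lt_succ_self n), h⟩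
    · exact Or.inr ⟨n, Nat.lt_succ_self n, hf, hn⟩

theorem linEval_mem_span (W : Fin (N + 2) → L) {f : DiffPoly Unit F} {k : ℕ}
    (hf : f ∈ linForms F k) :
    linEval F N W f ∈ Submodule.span F (W '' {c | N < k + c}) := by
  rw [linEval_apply]
  refine sum_mem fun c _ => ?_
  by_cases hc : N < k + c
  · rw [← Algebra.smul_def]
    exact Submodule.smul_mem _ _ (Submodule.subset_span ⟨c, hc, rfl⟩)
  · rw [colExp, if_pos (by omega), coeff_single_of_mem_linForms hf (by omega), map_zero, zero_mul]
    exact zero_mem _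

/-- The column of `u⁽ᵗ⁻¹⁾`, and the column of `1` for `t = 0`. -/
def colOf (N t : ℕ) : Fin (N + 2) := ⟨N + 1 - t, by omega⟩

/-- Solving for the leading term puts relations in echelon form: different leading derivatives yield
different dependent columns. -/
theorem mem_span_of_linEval_eq_zero (W : Fin (N + 2) → L) {f : DiffPoly Unit F} {k : ℕ}
    (hk : k ≤ N) (hf : f ∈ linForms F (k + 1)) (hlead : f.coeff (Finsupp.single ((), k) 1) ≠ 0)
    (h0 : linEval F N W f = 0) :
    W (colOf N (k + 1)) ∈ Submodule.span F (W '' {c | colOf N (k + 1) < c}) := by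
  have hc : colOf N (k + 1) = ⟨N - k, by omega⟩ := Fin.ext (by simp [colOf])
  have h1 := linEval_mem_span W (sub_leading_mem_linForms hf)
  have h2 : linEval F N W (X ((), k)) = W (colOf N (k + 1)) := by
    have := linEval_X (F := F) W ⟨N - k, by omega⟩ (by simp)
    simp only [Nat.sub_sub_self hk] at this
    rw [this, hc]
  rw [map_sub, h0, ← smul_eq_C_mul, map_smul, h2, zero_sub, neg_mem_iff] at h1
  have h3 := Submodule.smul_mem _ (f.coeff (Finsupp.single ((), k) 1))⁻¹ h1
  rw [inv_smul_smul₀ hlead] at h3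
  refine Submodule.span_mono (Set.image_mono ?_) h3
  intro c hc'
  rw [Set.mem_ofPred] at hc' ⊢
  rw [Fin.lt_def, colOf]
  simp only
  omega

theorem exists_mem_span_of_linEval_eq_zero (W : Fin (N + 2) → L) {f : DiffPoly Unit F} {n : ℕ}
    (hn : n ≤ N + 1) (hf : f ∈ linForms F n) (hf0 : f ≠ 0) (h0 : linEval F N W f = 0) :
    ∃ t ≤ n, W (colOf N t) ∈ Submodule.span F (W '' {c | colOf N t < c}) := by
  rcases exists_leading_of_mem_linForms hf hf0 with ⟨a, ha, rfl⟩ | ⟨k, hk, hfk, hlead⟩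
  · refine ⟨0, Nat.zero_le _, ?_⟩
    rw [← mul_one (C a), ← smul_eq_C_mul, map_smul, linEval_one, smul_eq_zero] at h0
    have : W (colOf N 0) = 0 := h0.resolve_left ha
    rw [this]
    exact zero_mem _
  · exact ⟨k + 1, hk, mem_span_of_linEval_eq_zero W (by omega) hfk hlead h0⟩

theorem mem_of_forall_mem_span {n : ℕ} (W : Fin n → L) {D : Finset (Fin n)}
    (hD : ∀ c ∈ D, W c ∈ Submodule.span F (W '' {c' | c < c'})) {V : Submodule F L}
    (hV : ∀ c ∉ D, W c ∈ V) (c : Fin n) : W c ∈ V := by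
  induction c using WellFoundedGT.induction with
  | _ c ih =>
    by_cases hc : c ∈ D
    · refine (Submodule.span_le.2 ?_ : _ ≤ V) (hD c hc)
      rintro _ ⟨c', hc', rfl⟩
      exact ih c' hc'
    · exact hV c hc

theorem linEval_mem {E : IntermediateField F L} {W : Fin (N + 2) → L} (hW : ∀ c, W c ∈ E)
    (f : DiffPoly Unit F) : linEval F N W f ∈ E := by
  rw [linEval_apply]
  exact sum_mem fun c _ => mul_mem (E.algebraMap_mem _) (hW c)

theorem linEval_smul (a : L) (W : Fin (N + 2) → L) (f : DiffPoly Unit F) :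
    linEval F N (a • W) f = a * linEval F N W f := by
  rw [linEval_apply, linEval_apply, Finset.mul_sum]
  exact Finset.sum_congr rfl fun c _ => by rw [Pi.smul_apply, smul_eq_mul, mul_left_comm]

end Dimension

/-! ### Transcendence degree bounds for kernel vectors -/

section Kernel

variable {F L : Type*} [Field F] [Differential F] [Field L] [Algebra F L]
  {P Q : Fin 2 → DiffPoly Unit F} {m₁ m₂ : ℕ} {φ : DiffPoly (Fin 2) F →ₐ[F] L}
  {W : Fin (m₁ + m₂ + 2) → L}

theorem sum_range_of_kernel (hW : ∀ r, ∑ c, φ (paramMatrix P Q m₁ m₂ r c) * W c = 0) {i : Fin 2}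
    {k : ℕ} (hk : k ≤ topOrd m₁ m₂ i) :
    ∑ a ∈ Finset.range (k + 1), k.choose a • (φ (X (i, a)) *
      linEval F (m₁ + m₂) W (iterDeriv (k - a) (Q i))) =
      linEval F (m₁ + m₂) W (iterDeriv k (P i)) := by
  obtain ⟨r, hr⟩ := exists_rowIdx_eq m₁ m₂ (v := (i, k)) hk
  have := hW r
  rw [sum_map_paramMatrix, hr, sub_eq_zero, Finset.Nat.sum_antidiagonal_eq_sum_range_succ_mk] at this
  exact this

/-- In the row of order k + s the terms with zᵢ⁽ᵃ⁾, a > k, carry a vanishing value of a derivative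
of Qᵢ of order below s. The term a = k has a nonzero coefficient, the binomial factor being
invertible in characteristic 0. -/
theorem map_X_mem_of_kernel [CharZero F] (hW : ∀ r, ∑ c, φ (paramMatrix P Q m₁ m₂ r c) * W c = 0)
    {E : IntermediateField F L} (hE : ∀ c, W c ∈ E) {i : Fin 2} {s : ℕ}
    (hlt : ∀ b < s, linEval F (m₁ + m₂) W (iterDeriv b (Q i)) = 0)
    (hs : linEval F (m₁ + m₂) W (iterDeriv s (Q i)) ≠ 0) {k : ℕ} (hk : k + s ≤ topOrd m₁ m₂ i) :
    φ (X (i, k)) ∈ E := by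
  have : CharZero L := charZero_of_injective_algebraMap (algebraMap F L).injective
  induction k using Nat.strong_induction_on with
  | _ k ih =>
    have h1 := sum_range_of_kernel hW hk
    rw [← Finset.sum_subset (Finset.range_subset_range.2 (show k + 1 ≤ k + s + 1 by omega))
      (fun a ha ha' => by
        rw [Finset.mem_range] at ha ha'
        rw [hlt _ (by omega), mul_zero, smul_zero]), Finset.sum_range_succ, Nat.add_sub_cancel_left,
      ← eq_sub_iff_add_eq'] at h1
    have h2 : (k + s).choose k • (φ (X (i, k)) *
        linEval F (m₁ + m₂) W (iterDeriv s (Q i))) ∈ E := by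
      rw [h1]
      refine sub_mem (linEval_mem hE _) (sum_mem fun a ha => nsmul_mem (mul_mem ?_
        (linEval_mem hE _)) _)
      have := Finset.mem_range.1 ha
      exact ih a this (by omega)
    have h3 : (((k + s).choose k : ℕ) : L) * linEval F (m₁ + m₂) W (iterDeriv s (Q i)) ≠ 0 :=
      mul_ne_zero (Nat.cast_ne_zero.2 (Nat.choose_pos (Nat.le_add_right k s)).ne') hs
    rw [nsmul_eq_mul, mul_left_comm] at h2
    have h4 := mul_mem h2 (inv_mem (mul_mem (natCast_mem E ((k + s).choose k))
      (linEval_mem hE (iterDeriv s (Q i)))))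
    rwa [mul_inv_cancel_right₀ h3] at h4

theorem linEval_num_eq_zero (hW : ∀ r, ∑ c, φ (paramMatrix P Q m₁ m₂ r c) * W c = 0)
    {i : Fin 2} {s : ℕ} (hlt : ∀ b < s, linEval F (m₁ + m₂) W (iterDeriv b (Q i)) = 0) {b : ℕ}
    (hb : b < s) (hbt : b ≤ topOrd m₁ m₂ i) :
    linEval F (m₁ + m₂) W (iterDeriv b (P i)) = 0 := by
  rw [← sum_range_of_kernel hW hbt]
  refine Finset.sum_eq_zero fun a _ => ?_
  rw [hlt _ (by omega), mul_zero, smul_zero]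

/-- The s + 1 linear relations and scaling leave at most m₁ + m₂ - s free entries of W. These and s
derivatives of y determine all the variables in `cutVars` up to algebraic dependence, although those
are m₁ + m₂ + 1 independent quantities. -/
theorem false_of_card_eq [CharZero F] (hW : ∀ r, ∑ c, φ (paramMatrix P Q m₁ m₂ r c) * W c = 0) (hW0 : W ≠ 0)
    (hφ : AlgebraicIndependent F fun v : cutVars m₁ m₂ 0 => φ (X (v : Fin 2 × ℕ)))
    (hQ0 : linEval F (m₁ + m₂) W (Q 0) ≠ 0) {s : ℕ}
    (hlt : ∀ b < s, linEval F (m₁ + m₂) W (iterDeriv b (Q 1)) = 0)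
    (hs : s ≤ m₁ + 1) (hs' : s ≤ m₁ → linEval F (m₁ + m₂) W (iterDeriv s (Q 1)) ≠ 0)
    {D : Finset (Fin (m₁ + m₂ + 2))} (hDcard : D.card = s + 1)
    (hD : ∀ c ∈ D, W c ∈ Submodule.span F (W '' {c' | c < c'})) : False := by
  classical
  obtain ⟨c₀, hc₀, hWc₀⟩ : ∃ c ∉ D, W c ≠ 0 := by
    by_contra! h
    refine hW0 (funext fun c => ?_)
    have := mem_of_forall_mem_span W hD (V := ⊥) (fun c hc => (Submodule.mem_bot F).2 (h c hc)) c
    exact (Submodule.mem_bot F).1 this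
  set W' := (W c₀)⁻¹ • W with hW'
  have hker : ∀ r, ∑ c, φ (paramMatrix P Q m₁ m₂ r c) * W' c = 0 := by
    intro r
    have := congrArg ((W c₀)⁻¹ * ·) (hW r)
    simp only [mul_zero, Finset.mul_sum] at this
    rw [← this]
    exact Finset.sum_congr rfl fun c _ => by rw [hW', Pi.smul_apply, smul_eq_mul, mul_left_comm]
  have hlin : ∀ f, linEval F (m₁ + m₂) W' f = (W c₀)⁻¹ * linEval F (m₁ + m₂) W f := linEval_smul _ _
  have hne : ∀ {f}, linEval F (m₁ + m₂) W f ≠ 0 → linEval F (m₁ + m₂) W' f ≠ 0 := fun h => by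
    rw [hlin]
    exact mul_ne_zero (inv_ne_zero hWc₀) h
  have heq : ∀ {f}, linEval F (m₁ + m₂) W f = 0 → linEval F (m₁ + m₂) W' f = 0 := fun h => by
    rw [hlin, h, mul_zero]
  let A : Finset L := (Finset.univ \ insert c₀ D).image W'
  -- The first nonvanishing derivative of Q₁ having order s, the rows recover y⁽ᵏ⁾ only for k ≤ m₁ -
  -- s; the remaining s are adjoined.
  let Y : Finset L := (Finset.Ico (m₁ + 1 - s) (m₁ + 1)).image fun k => φ (X (1, k))
  let E := algCl F (↑(A ∪ Y) : Set L)
  have hAY : (A ∪ Y).card ≤ m₁ + m₂ := by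
    refine (Finset.card_union_le _ _).trans ?_
    have h1 : A.card ≤ (m₁ + m₂ + 2) - (s + 2) := by
      refine Finset.card_image_le.trans ?_
      rw [Finset.card_sdiff_of_subset (Finset.subset_univ _), Finset.card_insert_of_notMem hc₀,
        hDcard, Finset.card_univ, Fintype.card_fin]
    have h2 : Y.card ≤ s := by
      refine Finset.card_image_le.trans ?_
      rw [Nat.card_Ico]
      omega
    have h3 : s + 2 ≤ m₁ + m₂ + 2 := by
      have := Finset.card_le_univ (insert c₀ D)
      rw [Finset.card_insert_of_notMem hc₀, hDcard, Fintype.card_fin] at this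
      exact this
    omega
  have hsub : ∀ x ∈ A ∪ Y, x ∈ E := fun x hx => subset_algCl _ (Finset.mem_coe.2 hx)
  have hWE : ∀ c, W' c ∈ E := by
    refine mem_of_forall_mem_span W' (D := D) (V := Subalgebra.toSubmodule E.toSubalgebra) ?_ ?_
    · intro c hc
      have h1 := Submodule.mem_map_of_mem (f := LinearMap.mulLeft F (W c₀)⁻¹) (hD c hc)
      rw [Submodule.map_span, ← Set.image_comp] at h1
      exact h1
    · intro c hc
      rcases eq_or_ne c c₀ with rfl | hcc
      · have : W' c = 1 := by rw [hW', Pi.smul_apply, smul_eq_mul, inv_mul_cancel₀ hWc₀]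
        rw [this]
        exact one_mem E
      · refine hsub _ (Finset.mem_union_left _ (Finset.mem_image_of_mem _ ?_))
        simp [hcc, hc]
  have hX : ∀ v ∈ cutVars m₁ m₂ 0, φ (X v) ∈ E := by
    rintro ⟨i, k⟩ ⟨h1, -⟩
    by_cases hi : i = 0
    · subst hi
      exact map_X_mem_of_kernel hker hWE (s := 0) (fun b hb => absurd hb (Nat.not_lt_zero b))
        (hne hQ0) h1
    · obtain rfl : i = 1 := by omega
      by_cases hk : k + s ≤ m₁
      · exact map_X_mem_of_kernel hker hWE (fun b hb => heq (hlt b hb)) (hne (hs' (by omega))) hk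
      · refine hsub _ (Finset.mem_union_right _ (Finset.mem_image_of_mem (fun k => φ (X (1, k))) ?_))
        have : k ≤ m₁ := h1
        rw [Finset.mem_Ico]
        omega
  let ι : Fin m₂ ⊕ Fin (m₁ + 1) → cutVars m₁ m₂ 0 := Sum.elim
    (fun k => ⟨(0, k), k.2.le, fun _ => k.2⟩)
    (fun k => ⟨(1, k), Nat.lt_succ_iff.1 k.2, fun h => absurd h (by simp)⟩)
  have hι : Function.Injective ι := by
    rintro (a | a) (b | b) h <;> have h' := congrArg Subtype.val h <;>
      simp [ι, Fin.ext_iff] at h' ⊢ <;> exact h'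
  have := card_le_of_forall_mem_algCl (hφ.comp ι hι) (Finset.finite_toSet (A ∪ Y))
    fun k => hX _ (ι k).2
  rw [Set.ncard_coe_finset] at this
  simp only [Fintype.card_sum, Fintype.card_fin] at this
  omega

end Kernel

/-! ### Specializations of the generic point -/

section Specialization

variable {F K L : Type*} [Field F] [Field K] [Algebra F K] [Field L] [Algebra F L]

/-- The pairs of values of a rational function at a generic point `ev` and at a specialization
`Ψ` of it. -/
def specialization {A : Type*} [CommRing A] [Algebra F A] (ev : A →ₐ[F] K) (Ψ : A →ₐ[F] L) :
    Subalgebra F (K × L) where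
  carrier := {z | ∃ num den : A, Ψ den ≠ 0 ∧ z.1 * ev den = ev num ∧ z.2 * Ψ den = Ψ num}
  mul_mem' := by
    rintro z z' ⟨n, d, h1, h2, h3⟩ ⟨n', d', h1', h2', h3'⟩
    refine ⟨n * n', d * d', by rw [map_mul]; exact mul_ne_zero h1 h1', ?_, ?_⟩
    · rw [map_mul, map_mul, ← h2, ← h2', Prod.fst_mul]; ring
    · rw [map_mul, map_mul, ← h3, ← h3', Prod.snd_mul]; ring
  add_mem' := by
    rintro z z' ⟨n, d, h1, h2, h3⟩ ⟨n', d', h1', h2', h3'⟩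
    refine ⟨n * d' + n' * d, d * d', by rw [map_mul]; exact mul_ne_zero h1 h1', ?_, ?_⟩
    · rw [map_mul, map_add, map_mul, map_mul, ← h2, ← h2', Prod.fst_add]; ring
    · rw [map_mul, map_add, map_mul, map_mul, ← h3, ← h3', Prod.snd_add]; ring
  algebraMap_mem' a := ⟨algebraMap F A a, 1, by simp, by simp, by simp⟩

variable {A : Type*} [CommRing A] [Algebra F A] {ev : A →ₐ[F] K} {Ψ : A →ₐ[F] L}

theorem prod_mem_specialization (a : A) : ev.prod Ψ a ∈ specialization ev Ψ :=
  ⟨a, 1, by simp, by simp, by simp⟩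

theorem mem_specialization_of_mul_mem {z : K × L} {a : A} (ha : Ψ a ≠ 0)
    (h : z * ev.prod Ψ a ∈ specialization ev Ψ) : z ∈ specialization ev Ψ := by
  obtain ⟨n, d, h1, h2, h3⟩ := h
  refine ⟨n, a * d, by rw [map_mul]; exact mul_ne_zero ha h1, ?_, ?_⟩
  · rw [← h2, map_mul, ← mul_assoc]; rfl
  · rw [← h3, map_mul, ← mul_assoc]; rfl

theorem snd_eq_zero_of_fst_eq_zero (hev : ∀ a, ev a = 0 → a = 0) {z : K × L}
    (hz : z ∈ specialization ev Ψ) (h : z.1 = 0) : z.2 = 0 := by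
  obtain ⟨n, d, h1, h2, h3⟩ := hz
  rw [h, zero_mul] at h2
  rw [hev n h2.symm, map_zero] at h3
  exact (mul_eq_zero.1 h3).resolve_right h1

end Specialization

section Transfer

variable {F K L : Type*} [Field F] [Differential F] [Field K] [Algebra F K]
  [Differential K] [DifferentialAlgebra F K] [Field L] [Algebra F L] {u : K}
  {P Q : Fin 2 → DiffPoly Unit F} {m : Fin 2 → ℕ} {φ : DiffPoly (Fin 2) F →ₐ[F] L}
  {W : Fin (m 0 + m 1 + 2) → L}

/-- With last entry 1, W is the image of the jet of u under a homomorphism from F{u}. Since its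
values on Q₀ and Q₁ are nonzero, it extends to the derivatives of η in the box and sends them to the
images under φ, so relations are preserved. -/
theorem map_eq_zero_of_aeval_eq_zero (hu : DiffTranscendental F u)
    (h : ∀ i, IsLinFrac (P i) (Q i) (m i))
    (hW : ∀ r, ∑ c, φ (paramMatrix P Q (m 0) (m 1) r c) * W c = 0)
    (hQ : ∀ i, linEval F (m 0 + m 1) W (Q i) ≠ 0) (hlast : W (Fin.last _) = 1)
    {f : DiffPoly (Fin 2) F} (hf : f ∈ supported F (boxVars (m 0) (m 1)))
    (h0 : aeval (jetValue (paramPoint u P Q)) f = 0) : φ f = 0 := by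
  -- The value 0 beyond order N is arbitrary: the rows involve no higher derivative of u.
  set w : ℕ → L := fun k => if k ≤ m 0 + m 1 then W ⟨m 0 + m 1 - k, by omega⟩ else 0 with hw
  have hWw : W = jetVec (m 0 + m 1) w := by
    ext c
    rw [jetVec]
    split_ifs with hc
    · simp only [hw, Nat.sub_le, if_true, Nat.sub_sub_self hc]
    · rw [← hlast]
      exact congrArg W (Fin.ext (by simp; omega))
  set ev := (aeval (fun v : Unit × ℕ => iterDeriv v.2 u) : DiffPoly Unit F →ₐ[F] K) with hev
  set Ψ := (aeval (fun v : Unit × ℕ => w v.2) : DiffPoly Unit F →ₐ[F] L) with hΨ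
  have hevinj : ∀ a, ev a = 0 → a = 0 := by
    intro a ha
    by_contra hne
    exact hu.evalAt_ne_zero hne ha
  have hlin : ∀ f ∈ linForms F (m 0 + m 1 + 1), linEval F (m 0 + m 1) W f = Ψ f := by
    intro f hf
    rw [hWw, linEval_jetVec w hf]
  have hvar : ∀ i k, k ≤ topOrd (m 0) (m 1) i →
      ((jetValue (paramPoint u P Q) (i, k), φ (X (i, k))) : K × L) ∈ specialization ev Ψ := by
    intro i k
    induction k using Nat.strong_induction_on with
    | _ k ih =>
      intro hk
      have h1 := sum_antidiagonal_evalAt (paramPoint_mul hu h i) k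
      have h2 := sum_range_of_kernel hW hk
      rw [Finset.Nat.sum_antidiagonal_eq_sum_range_succ_mk] at h1
      have h3 : ∑ a ∈ Finset.range (k + 1), k.choose a •
          (((jetValue (paramPoint u P Q) (i, a), φ (X (i, a))) : K × L) *
            ev.prod Ψ (iterDeriv (k - a) (Q i))) = ev.prod Ψ (iterDeriv k (P i)) := by
        refine Prod.ext ?_ ?_
        · rw [Prod.fst_sum]
          exact h1
        · rw [Prod.snd_sum]
          change _ = Ψ (iterDeriv k (P i))
          rw [← hlin _ (iterDeriv_mem_linForms_of_le (h i).num_mem hk), ← h2]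
          refine Finset.sum_congr rfl fun a _ => ?_
          rw [hlin _ (iterDeriv_mem_linForms_of_le (h i).den_mem (by omega))]
          rfl
      rw [Finset.sum_range_succ, Nat.choose_self, one_smul, Nat.sub_self, iterDeriv_zero,
        ← eq_sub_iff_add_eq'] at h3
      refine mem_specialization_of_mul_mem (a := Q i) ?_ ?_
      · have := hlin _ (iterDeriv_mem_linForms_of_le (k := 0) (h i).den_mem (Nat.zero_le _))
        rw [iterDeriv_zero] at this
        exact this ▸ hQ i
      · rw [h3]
        refine sub_mem (prod_mem_specialization _) (sum_mem fun a ha => nsmul_mem (mul_mem ?_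
          (prod_mem_specialization _)) _)
        have := Finset.mem_range.1 ha
        exact ih a this (by omega)
  have hmem : (aeval (jetValue (paramPoint u P Q)) : DiffPoly (Fin 2) F →ₐ[F] K).prod φ f ∈
      specialization ev Ψ := by
    rw [supported_eq_adjoin_X] at hf
    refine (Algebra.adjoin_le ?_ : _ ≤ (specialization ev Ψ).comap
      ((aeval (jetValue (paramPoint u P Q)) : DiffPoly (Fin 2) F →ₐ[F] K).prod φ)) hf
    rintro _ ⟨⟨i, k⟩, hk, rfl⟩
    have := hvar i k hk
    change ((aeval (jetValue (paramPoint u P Q)) (X (i, k) : DiffPoly (Fin 2) F),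
      φ (X (i, k))) : K × L) ∈ specialization ev Ψ
    rwa [aeval_X]
  exact snd_eq_zero_of_fst_eq_zero hevinj hmem h0

/-- P₁, Q₁ and their derivatives of order below s all annihilate W. A form B of exact order m 1 and
its derivatives give s relations with distinct leading terms; eliminating the leading term between
P₁ and Q₁ gives one more, of lower order. -/
theorem exists_elimination (h : IsLinFrac (P 1) (Q 1) (m 1))
    (hW : ∀ r, ∑ c, φ (paramMatrix P Q (m 0) (m 1) r c) * W c = 0) {s : ℕ} (hs0 : 0 < s)
    (hs : s ≤ m 0 + 1) (hlt : ∀ b < s, linEval F (m 0 + m 1) W (iterDeriv b (Q 1)) = 0) :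
    ∃ D : Finset (Fin (m 0 + m 1 + 2)), D.card = s + 1 ∧
      ∀ c ∈ D, W c ∈ Submodule.span F (W '' {c' | c < c'}) := by
  classical
  have hnum : ∀ b < s, linEval F (m 0 + m 1) W (iterDeriv b (P 1)) = 0 := fun b hb =>
    linEval_num_eq_zero hW hlt hb (Nat.lt_succ_iff.1 (lt_of_lt_of_le hb hs))
  -- The form C′ is Q₁ if that has order below m 1, and otherwise P₁ minus a constant multiple of
  -- Q₁, which is nonzero by coprimality.
  obtain ⟨B, C', hB, hBlead, hB0, hC', hC'0, hC'W⟩ : ∃ B C' : DiffPoly Unit F,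
      B ∈ linForms F (m 1 + 1) ∧ B.coeff (Finsupp.single ((), m 1) 1) ≠ 0 ∧
      (∀ b < s, linEval F (m 0 + m 1) W (iterDeriv b B) = 0) ∧ C' ∈ linForms F (m 1) ∧ C' ≠ 0 ∧
      linEval F (m 0 + m 1) W C' = 0 := by
    by_cases hq : (Q 1).coeff (Finsupp.single ((), m 1) 1) = 0
    · refine ⟨P 1, Q 1, h.num_mem, h.leading.resolve_right (not_not.2 hq), hnum, ?_,
        h.den_ne_zero, hlt 0 hs0⟩
      have := sub_leading_mem_linForms h.den_mem
      rwa [hq, C_0, zero_mul, sub_zero] at this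
    · set a := (P 1).coeff (Finsupp.single ((), m 1) 1) / (Q 1).coeff (Finsupp.single ((), m 1) 1)
        with ha
      have hmem : P 1 - a • Q 1 ∈ linForms F (m 1) := by
        have h1 := sub_leading_mem_linForms
          (sub_mem h.num_mem ((linForms F (m 1 + 1)).smul_mem a h.den_mem))
        rwa [coeff_sub, coeff_smul, smul_eq_mul, ha, div_mul_cancel₀ _ hq, sub_self, C_0, zero_mul,
          sub_zero] at h1
      refine ⟨Q 1, P 1 - a • Q 1, h.den_mem, hq, hlt, hmem, ?_, ?_⟩
      · intro h0
        rw [sub_eq_zero, smul_eq_C_mul] at h0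
        have hunit : IsUnit (Q 1) := h.relPrime (h0 ▸ dvd_mul_left _ _) dvd_rfl
        obtain ⟨b, -, hb⟩ := isUnit_iff_eq_C_of_isReduced.1 hunit
        apply hq
        rw [hb, coeff_C, if_neg (Finsupp.single_ne_zero.2 (one_ne_zero' ℕ)).symm]
      · have h1 := hnum 0 hs0
        have h2 := hlt 0 hs0
        rw [iterDeriv_zero] at h1 h2
        rw [map_sub, map_smul, h1, h2, smul_zero, sub_zero]
  obtain ⟨t, ht, hspan⟩ := exists_mem_span_of_linEval_eq_zero W (by omega) hC' hC'0 hC'W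
  -- The index t ≤ m 1 comes from C′; the index m 1 + 1 + b is the column of the leading term of
  -- B⁽ᵇ⁾.
  refine ⟨(insert t (Finset.Ico (m 1 + 1) (m 1 + 1 + s))).image (colOf (m 0 + m 1)), ?_, ?_⟩
  · rw [Finset.card_image_of_injOn, Finset.card_insert_of_notMem, Nat.card_Ico]
    · omega
    · rw [Finset.mem_Ico]
      omega
    · intro x hx y hy hxy
      rw [colOf, colOf, Fin.mk.injEq] at hxy
      simp only [Finset.coe_insert, Set.mem_insert_iff, Finset.mem_coe, Finset.mem_Ico] at hx hy
      omega
  · intro c hc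
    obtain ⟨t', ht', rfl⟩ := Finset.mem_image.1 hc
    rcases Finset.mem_insert.1 ht' with rfl | h'
    · exact hspan
    · rw [Finset.mem_Ico] at h'
      obtain ⟨b, rfl⟩ := Nat.exists_eq_add_of_le h'.1
      have h1 := iterDeriv_mem_linForms hB b
      rw [show m 1 + 1 + b = m 1 + b + 1 by ring] at h1 ⊢
      refine mem_span_of_linEval_eq_zero W (by omega) h1 ?_ (hB0 b (by omega))
      rw [coeff_iterDeriv_leading hB]
      exact hBlead

/-- Any kernel vector W of the specialized matrix turns out, after scaling, to be a specialization
of the jet of u, so `topCoeff` cannot vanish at η without vanishing under φ. -/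
theorem aeval_topCoeff_ne_zero [CharZero F] (hu : DiffTranscendental F u)
    (h : ∀ i, IsLinFrac (P i) (Q i) (m i))
    (hφ : AlgebraicIndependent F fun v : cutVars (m 0) (m 1) 0 => φ (X (v : Fin 2 × ℕ)))
    (hR : φ (paramMatrix P Q (m 0) (m 1)).det = 0)
    (hT : φ (topCoeff P Q (m 0) (m 1) 0) ≠ 0) :
    aeval (jetValue (paramPoint u P Q)) (topCoeff P Q (m 0) (m 1) 0) ≠ 0 := by
  classical
  obtain ⟨W, hW0, hW⟩ : ∃ W : Fin (m 0 + m 1 + 2) → L, W ≠ 0 ∧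
      ∀ r, ∑ c, φ (paramMatrix P Q (m 0) (m 1) r c) * W c = 0 := by
    rw [AlgHom.map_det] at hR
    obtain ⟨W, hW0, hW⟩ := Matrix.exists_mulVec_eq_zero_iff.2 hR
    exact ⟨W, hW0, fun r => congrFun hW r⟩
  -- If Q₀(W) = 0, the matrix whose determinant is `topCoeff` would annihilate W ≠ 0.
  have hQ0 : linEval F (m 0 + m 1) W (Q 0) ≠ 0 := by
    intro hQ0
    refine hW0 (funext fun c => ?_)
    have h1 := Matrix.map_det_mul (φ : DiffPoly (Fin 2) F →+* L)
      ((paramMatrix P Q (m 0) (m 1)).updateRow (topRow (m 0) (m 1) 0)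
        fun c => C ((Q 0).coeff (colExp (m 0 + m 1) c))) W c
    rw [Finset.sum_eq_zero] at h1
    · exact (mul_eq_zero.1 h1).resolve_left hT
    · intro r _
      simp only [RingHom.coe_coe]
      by_cases hr : r = topRow (m 0) (m 1) 0
      · subst hr
        simp only [Matrix.updateRow_self]
        rw [sum_map_C_coeff, hQ0, mul_zero]
      · simp only [Matrix.updateRow_ne hr]
        rw [hW, mul_zero]
  have hQ1 : linEval F (m 0 + m 1) W (Q 1) ≠ 0 := by
    intro hQ1
    -- Here s is the order of the first derivative of Q₁ not vanishing at W, or m 0 + 1, the number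
    -- of rows of the second polynomial, if none up to order m 0 survives.
    obtain ⟨s, hs0, hs, hlt, hs'⟩ : ∃ s, 0 < s ∧ s ≤ m 0 + 1 ∧
        (∀ b < s, linEval F (m 0 + m 1) W (iterDeriv b (Q 1)) = 0) ∧
        (s ≤ m 0 → linEval F (m 0 + m 1) W (iterDeriv s (Q 1)) ≠ 0) := by
      by_cases hex : ∃ b, b ≤ m 0 ∧ linEval F (m 0 + m 1) W (iterDeriv b (Q 1)) ≠ 0
      · obtain ⟨h1, h2⟩ := Nat.find_spec hex
        refine ⟨Nat.find hex, (Nat.find_pos hex).2 fun h0 => h0.2 hQ1, by omega, fun b hb => ?_,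
          fun _ => h2⟩
        by_contra hne
        exact Nat.find_min hex hb ⟨by omega, hne⟩
      · push Not at hex
        exact ⟨m 0 + 1, Nat.succ_pos _, le_rfl, fun b hb => hex b (Nat.lt_succ_iff.1 hb),
          fun h' => absurd h' (by omega)⟩
    obtain ⟨D, hDcard, hD⟩ := exists_elimination (h 1) hW hs0 hs hlt
    exact false_of_card_eq hW hW0 hφ hQ0 hlt hs hs' hDcard hD
  have hlast : W (Fin.last _) ≠ 0 := by
    intro hlast
    -- A zero last entry is itself the single linear relation needed for s = 0.
    refine false_of_card_eq hW hW0 hφ hQ0 (s := 0) (fun b hb => absurd hb (Nat.not_lt_zero b))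
      (Nat.zero_le _) (fun _ => hQ1) (D := {Fin.last _}) (Finset.card_singleton _) ?_
    intro c hc
    rw [Finset.mem_singleton.1 hc, hlast]
    exact zero_mem _
  intro h0
  refine hT (map_eq_zero_of_aeval_eq_zero (W := (W (Fin.last _))⁻¹ • W) hu h ?_ ?_ ?_
    (supported_mono (fun v hv => hv.1) (topCoeff_mem_supported P Q (m 0) (m 1) 0)) h0)
  · intro r
    have := congrArg ((W (Fin.last _))⁻¹ * ·) (hW r)
    simp only [mul_zero, Finset.mul_sum] at this
    rw [← this]
    exact Finset.sum_congr rfl fun c _ => by rw [Pi.smul_apply, smul_eq_mul, mul_left_comm]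
  · intro i
    rw [linEval_smul]
    refine mul_ne_zero (inv_ne_zero hlast) ?_
    fin_cases i
    · exact hQ0
    · exact hQ1
  · rw [Pi.smul_apply, smul_eq_mul, inv_mul_cancel₀ hlast]

end Transfer

/-! ### Polynomials of degree at most one in a variable -/

section LinearVariable

variable {τ F : Type*} [Field F]

theorem mem_vars_of_dvd {f g : MvPolynomial τ F} (hg : g ≠ 0) (h : f ∣ g) {v : τ}
    (hv : v ∈ f.vars) : v ∈ g.vars := by
  obtain ⟨c, rfl⟩ := h
  rw [mem_vars_iff_degreeOf_ne_zero] at hv ⊢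
  rw [degreeOf_mul_eq (left_ne_zero_of_mul hg) (right_ne_zero_of_mul hg)]
  omega

theorem pderiv_mem_supported {s : Set τ} {v : τ} {f : MvPolynomial τ F}
    (hf : ∀ w ∈ f.vars, w ≠ v → w ∈ s) (hv : f.degreeOf v ≤ 1) :
    pderiv v f ∈ supported F s ∧ f - X v * pderiv v f ∈ supported F s := by
  classical
  have key : ∀ t ∈ f.support, monomial (t - Finsupp.single v 1) (f.coeff t * t v) ∈ supported F s ∧
      monomial t (f.coeff t) - X v * monomial (t - Finsupp.single v 1) (f.coeff t * t v) ∈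
        supported F s := by
    intro t ht
    have ht1 : t v ≤ 1 := (degreeOf_le_iff.1 hv) t ht
    have hmem : ∀ (t' : τ →₀ ℕ) (a : F), (∀ w, t' w ≤ t w) → t' v = 0 →
        monomial t' a ∈ supported F s := by
      intro t' a hle h0
      refine mem_supported.2 fun w hw => ?_
      by_cases ha : a = 0
      · rw [ha, monomial_zero, vars_0] at hw
        exact absurd hw (Finset.notMem_empty w)
      · rw [Finset.mem_coe, vars_monomial ha, Finsupp.mem_support_iff] at hw
        refine hf w ((mem_vars_iff_mem_support w).2 ⟨t, ht, ?_⟩) ?_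
        · rw [Finsupp.mem_support_iff]
          have := hle w
          omega
        · rintro rfl
          exact hw h0
    have h1 : monomial (t - Finsupp.single v 1) (f.coeff t * t v) ∈ supported F s := by
      refine hmem _ _ (fun w => ?_) ?_
      · rw [Finsupp.tsub_apply]
        exact Nat.sub_le _ _
      · rw [Finsupp.tsub_apply, Finsupp.single_eq_same]
        omega
    refine ⟨h1, ?_⟩
    rcases Nat.le_one_iff_eq_zero_or_eq_one.1 ht1 with h0 | h0
    · rw [h0, Nat.cast_zero, mul_zero, monomial_zero, mul_zero, sub_zero]
      exact hmem _ _ (fun w => le_rfl) h0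
    · have hle : Finsupp.single v 1 ≤ t := Finsupp.single_le_iff.2 h0.ge
      rw [h0, Nat.cast_one, mul_one, X, monomial_mul, one_mul, add_tsub_cancel_of_le hle, sub_self]
      exact zero_mem _
  have hsum : pderiv v f = ∑ t ∈ f.support, monomial (t - Finsupp.single v 1) (f.coeff t * t v) := by
    conv_lhs => rw [f.as_sum]
    rw [map_sum]
    exact Finset.sum_congr rfl fun t _ => pderiv_monomial
  refine ⟨by rw [hsum]; exact sum_mem fun t ht => (key t ht).1, ?_⟩
  have hsub : f - X v * pderiv v f = ∑ t ∈ f.support, (monomial t (f.coeff t) -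
      X v * monomial (t - Finsupp.single v 1) (f.coeff t * t v)) := by
    rw [hsum, Finset.sum_sub_distrib, ← f.as_sum, Finset.mul_sum]
  rw [hsub]
  exact sum_mem fun t ht => (key t ht).2

theorem degreeOf_X_mul_add_le [DecidableEq τ] {v : τ} {f g : MvPolynomial τ F} {s : Set τ}
    (hv : v ∉ s) (hf : f ∈ supported F s) (hg : g ∈ supported F s) :
    (X v * f + g).degreeOf v ≤ 1 := by
  have h0 : ∀ {p : MvPolynomial τ F}, p ∈ supported F s → p.degreeOf v = 0 := fun hp => by
    by_contra h
    exact hv (mem_supported.1 hp (mem_vars_iff_degreeOf_ne_zero.2 h))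
  refine (degreeOf_add_le _ _ _).trans (max_le ((degreeOf_mul_le _ _ _).trans ?_) ?_)
  · rw [h0 hf, add_zero, degreeOf_X, if_pos rfl]
  · rw [h0 hg]
    exact Nat.zero_le _

theorem pderiv_ne_zero [CharZero F] {v : τ} {f : MvPolynomial τ F} (hv : f.degreeOf v = 1) :
    pderiv v f ≠ 0 := by
  intro h
  have := (pderiv_mem_supported (s := {w | w ≠ v}) (f := f) (v := v) (fun w _ hw => hw) hv.le).2
  rw [h, mul_zero, sub_zero] at this
  have hmem : v ∈ f.vars := mem_vars_iff_degreeOf_ne_zero.2 (by omega)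
  exact (mem_supported.1 this hmem) rfl

end LinearVariable

/-! ### Pseudo-reduction modulo a polynomial linear in its leader -/

section Reduction

variable {σ F : Type*} [Field F]

/-- The polynomials that become congruent modulo `J` to an element of `V` after multiplication by
a power of `S`. -/
def reducible (J : Ideal (DiffPoly σ F)) (V : Subalgebra F (DiffPoly σ F)) {S : DiffPoly σ F}
    (hS : S ∈ V) : Subalgebra F (DiffPoly σ F) where
  carrier := {f | ∃ k : ℕ, ∃ r ∈ V, S ^ k * f - r ∈ J}
  mul_mem' := by
    rintro f g ⟨k, r, hr, h⟩ ⟨l, r', hr', h'⟩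
    refine ⟨k + l, r * r', mul_mem hr hr', ?_⟩
    convert add_mem (J.mul_mem_right (S ^ l * g) h) (J.mul_mem_left r h') using 1
    ring
  add_mem' := by
    rintro f g ⟨k, r, hr, h⟩ ⟨l, r', hr', h'⟩
    refine ⟨k + l, S ^ l * r + S ^ k * r', add_mem (mul_mem (pow_mem hS _) hr)
      (mul_mem (pow_mem hS _) hr'), ?_⟩
    convert add_mem (J.mul_mem_left (S ^ l) h) (J.mul_mem_left (S ^ k) h') using 1
    ring
  algebraMap_mem' a := ⟨0, algebraMap F _ a, V.algebraMap_mem a, by simp⟩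

variable {J : Ideal (DiffPoly σ F)} {V : Subalgebra F (DiffPoly σ F)} {S : DiffPoly σ F}

theorem mem_reducible_of_mem (hS : S ∈ V) {f : DiffPoly σ F} (hf : f ∈ V) :
    f ∈ reducible J V hS := ⟨0, f, hf, by simp⟩

theorem mem_reducible_of_mul_add_mem (hS : S ∈ V) {f g : DiffPoly σ F}
    (hg : g ∈ reducible J V hS) (h : S * f + g ∈ J) : f ∈ reducible J V hS := by
  obtain ⟨k, r, hr, hk⟩ := hg
  refine ⟨k + 1, -r, neg_mem hr, ?_⟩
  convert sub_mem (J.mul_mem_left (S ^ k) h) hk using 1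
  ring

/-- The variables other than the derivatives of `zᵢ` of order at least `n`. -/
def lowVars (i : σ) (n : ℕ) : Set (σ × ℕ) := {v | v.1 = i → v.2 < n}

theorem lowVars_mono (i : σ) {n n' : ℕ} (h : n ≤ n') : lowVars i n ⊆ lowVars i n' :=
  fun _ hv h' => lt_of_lt_of_le (hv h') h

variable [Differential F]

theorem deriv_mem_supported_lowVars {i : σ} {n : ℕ} {f : DiffPoly σ F}
    (hf : f ∈ supported F (lowVars i n)) :
    Differential.deriv f ∈ supported F (lowVars i (n + 1)) := by
  refine deriv_mem_supported (s := lowVars i n) (t := lowVars i (n + 1)) (fun a k h => ?_) hf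
  have h1 : a = i → k < n := h
  exact ⟨fun h' => (h1 h').trans (Nat.lt_succ_self n), fun h' => Nat.succ_lt_succ (h1 h')⟩

theorem iterDeriv_mem_supported_lowVars {i : σ} {n : ℕ} {f : DiffPoly σ F}
    (hf : f ∈ supported F (lowVars i n)) (k : ℕ) :
    iterDeriv k f ∈ supported F (lowVars i (n + k)) := by
  induction k with
  | zero => exact hf
  | succ k ih => rw [iterDeriv_succ]; exact deriv_mem_supported_lowVars ih

theorem iterDeriv_sub_mem_supported_lowVars {i : σ} {n : ℕ} {A S : DiffPoly σ F}
    (hS : S ∈ supported F (lowVars i n)) (hA : A - X (i, n) * S ∈ supported F (lowVars i n))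
    (k : ℕ) : iterDeriv k A - S * X (i, n + k) ∈ supported F (lowVars i (n + k)) := by
  induction k with
  | zero => rwa [iterDeriv_zero, add_zero, mul_comm]
  | succ k ih =>
    have h1 := deriv_mem_supported_lowVars ih
    have h2 : Differential.deriv S ∈ supported F (lowVars i (n + k + 1)) :=
      supported_mono (lowVars_mono i (by omega)) (deriv_mem_supported_lowVars hS)
    have h3 : (X (i, n + k) : DiffPoly σ F) ∈ supported F (lowVars i (n + k + 1)) :=
      X_mem_supported.2 fun _ => Nat.lt_succ_self _
    rw [map_sub, ← iterDeriv_succ, Derivation.leibniz, deriv_diffPoly_X, smul_eq_mul,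
      smul_eq_mul] at h1
    rw [← add_assoc]
    convert add_mem h1 (mul_mem h2 h3) using 1
    ring

/-- A⁽ʲ⁾ equals S · zᵢ⁽ⁿ⁺ʲ⁾ plus lower terms, so multiplying by powers of S removes the variables
from the top down. Linearity of A in its leader makes S both initial and separant. The bound k also
covers purely algebraic division by A, with k = 1 and J generated by A alone. -/
theorem supported_lowVars_le_reducible {i : σ} {n : ℕ} {A : DiffPoly σ F}
    (hS : S ∈ supported F (lowVars i n)) (hA : A - X (i, n) * S ∈ supported F (lowVars i n))
    (k : ℕ) (hJ : ∀ j < k, iterDeriv j A ∈ J) :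
    supported F (lowVars i (n + k)) ≤ reducible J (supported F (lowVars i n)) hS := by
  induction k with
  | zero => exact fun f hf => mem_reducible_of_mem hS hf
  | succ k ih =>
    have ih' := ih fun j hj => hJ j (hj.trans (Nat.lt_succ_self k))
    rw [supported_eq_adjoin_X]
    refine Algebra.adjoin_le ?_
    rintro _ ⟨⟨a, l⟩, hv, rfl⟩
    by_cases hal : (a, l) ∈ lowVars i (n + k)
    · exact ih' (X_mem_supported.2 hal)
    · have hai : a = i := by
        by_contra hne
        exact hal fun h => absurd h hne
      subst hai
      have hl : l = n + k := by
        have h1 : l < n + (k + 1) := hv rfl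
        have h2 : ¬ l < n + k := fun h => hal fun _ => h
        omega
      subst hl
      refine mem_reducible_of_mul_add_mem hS (ih' (iterDeriv_sub_mem_supported_lowVars hS hA k)) ?_
      rw [add_sub_cancel]
      exact hJ k (Nat.lt_succ_self k)

theorem exists_pow_mul_sub_mem_diffIdeal {i : σ} {n : ℕ} {A : DiffPoly σ F}
    (hS : S ∈ supported F (lowVars i n)) (hA : A - X (i, n) * S ∈ supported F (lowVars i n))
    (f : DiffPoly σ F) :
    ∃ k : ℕ, ∃ r ∈ supported F (lowVars i n), S ^ k * f - r ∈ diffIdeal A := by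
  obtain ⟨c, hc⟩ := (f.vars.image Prod.snd).bddAbove
  have hf : f ∈ supported F (lowVars i (n + (c + 1))) := by
    refine mem_supported.2 fun v hv _ => ?_
    have := hc (Finset.mem_coe.2 (Finset.mem_image.2 ⟨v, hv, rfl⟩))
    omega
  exact supported_lowVars_le_reducible hS hA (c + 1)
    (fun j _ => Ideal.subset_span (Set.mem_range_self j)) hf

theorem pderiv_iterDeriv [DecidableEq σ] {i : σ} {a : ℕ} {A : DiffPoly σ F}
    (hA : A ∈ supported F (lowVars i (a + 1))) (k : ℕ) :
    pderiv (i, a + k) (iterDeriv k A) = pderiv (i, a) A := by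
  induction k with
  | zero => rfl
  | succ k ih =>
    rw [iterDeriv_succ, ← add_assoc, pderiv_deriv_succ, ih, pderiv_eq_zero_of_mem_supported
      (iterDeriv_mem_supported_lowVars hA k), map_zero, zero_add]
    intro h
    have := h rfl
    simp only at this
    omega

end Reduction

/-! ### Orders and separants -/

section Order

variable {σ R : Type*} [DecidableEq σ] [CommRing R]

theorem ordIn_le_coe_iff {i : σ} {f : DiffPoly σ R} {n : ℕ} :
    ordIn i f ≤ n ↔ ∀ k, (i, k) ∈ f.vars → k ≤ n := by
  unfold ordIn
  rw [Finset.sup_le_iff]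
  constructor
  · intro h k hk
    exact WithBot.coe_le_coe.1 (h (i, k) (Finset.mem_filter.2 ⟨hk, rfl⟩))
  · rintro h ⟨a, k⟩ hk
    obtain ⟨hk', rfl⟩ := Finset.mem_filter.1 hk
    exact WithBot.coe_le_coe.2 (h k hk')

theorem coe_le_ordIn {i : σ} {f : DiffPoly σ R} {k : ℕ} (hk : (i, k) ∈ f.vars) :
    (k : WithBot ℕ) ≤ ordIn i f := by
  have h : (i, k) ∈ f.vars.filter fun v => v.1 = i := Finset.mem_filter.2 ⟨hk, rfl⟩
  exact Finset.le_sup (f := fun v : σ × ℕ => ((v.2 : ℕ) : WithBot ℕ)) h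

theorem mem_vars_of_ordIn_eq_coe {i : σ} {f : DiffPoly σ R} {n : ℕ} (h : ordIn i f = n) :
    (i, n) ∈ f.vars := by
  by_contra hn
  cases n with
  | zero =>
    have : ordIn i f = ⊥ := by
      unfold ordIn
      rw [Finset.sup_eq_bot_iff]
      rintro ⟨a, k⟩ hk
      obtain ⟨hk', rfl⟩ := Finset.mem_filter.1 hk
      have h1 := ordIn_le_coe_iff.1 h.le k hk'
      rw [Nat.le_zero.1 h1] at hk'
      exact absurd hk' hn
    rw [h] at this
    exact WithBot.coe_ne_bot this
  | succ n =>
    have : ordIn i f ≤ n := ordIn_le_coe_iff.2 fun k hk => by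
      have h1 := ordIn_le_coe_iff.1 h.le k hk
      rcases Nat.lt_or_eq_of_le h1 with h2 | rfl
      · exact Nat.lt_succ_iff.1 h2
      · exact absurd hk hn
    rw [h] at this
    exact absurd (WithBot.coe_le_coe.1 this) (Nat.not_succ_le_self n)

theorem ordIn_eq_coe_iff {i : σ} {f : DiffPoly σ R} {n : ℕ} :
    ordIn i f = n ↔ (i, n) ∈ f.vars ∧ ∀ k, (i, k) ∈ f.vars → k ≤ n :=
  ⟨fun h => ⟨mem_vars_of_ordIn_eq_coe h, ordIn_le_coe_iff.1 h.le⟩,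
    fun h => le_antisymm (ordIn_le_coe_iff.2 h.2) (coe_le_ordIn h.1)⟩

theorem separant_eq {F : Type*} [Field F] {i : σ} {A : DiffPoly σ F} {n : ℕ}
    (h : ordIn i A = n) : separant i A = pderiv (i, n) A := by
  unfold separant
  rw [h]
  rfl

end Order

theorem ordTotal_lt_of_forall {σ R : Type*} [CommRing R] {f g : DiffPoly σ R} (hg : g.vars.Nonempty)
    (h : ∀ v ∈ f.vars, ∃ w ∈ g.vars, v.2 < w.2) : ordTotal f < ordTotal g := by
  unfold ordTotal
  obtain ⟨w, hw⟩ := hg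
  rw [Finset.sup_lt_iff (lt_of_lt_of_le (WithBot.bot_lt_coe w.2)
    (Finset.le_sup (f := fun v : σ × ℕ => ((v.2 : ℕ) : WithBot ℕ)) hw))]
  intro v hv
  obtain ⟨w, hw, hlt⟩ := h v hv
  exact lt_of_lt_of_le (WithBot.coe_lt_coe.2 hlt)
    (Finset.le_sup (f := fun v : σ × ℕ => ((v.2 : ℕ) : WithBot ℕ)) hw)

/-! ### Minimal linear relations and their main factor -/

section LinearRelation

variable {σ F K : Type*} [Field F] [Field K] [Algebra F K]
  [Differential K]

/-- `R` is a nonzero relation at `η`, of degree at most one in each of the variables `zᵢ⁽ⁿⁱ⁾`,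
such that every relation at `η` has order at least `nᵢ` in each `zᵢ`. -/
structure IsLinearRelation (η : σ → K) (n : σ → ℕ) (R : DiffPoly σ F) : Prop where
  ne_zero : R ≠ 0
  aeval_eq_zero : aeval (jetValue η) R = 0
  eq_zero_of_mem : ∀ i, ∀ f ∈ supported F (lowVars i (n i)), aeval (jetValue η) f = 0 → f = 0
  le_of_mem_vars : ∀ v ∈ R.vars, v.2 ≤ n v.1
  degreeOf_le : ∀ i, R.degreeOf (i, n i) ≤ 1

namespace IsLinearRelation

variable {η : σ → K} {n : σ → ℕ} {R A : DiffPoly σ F}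

theorem mem_vars_of_aeval_eq_zero (h : IsLinearRelation η n R) {f : DiffPoly σ F} (hf0 : f ≠ 0)
    (hf : ∀ v ∈ f.vars, v.2 ≤ n v.1) (h0 : aeval (jetValue η) f = 0) (i : σ) :
    (i, n i) ∈ f.vars := by
  by_contra hn
  refine hf0 (h.eq_zero_of_mem i f (mem_supported.2 ?_) h0)
  rintro ⟨a, k⟩ hv (rfl : a = i)
  refine lt_of_le_of_ne (hf _ hv) ?_
  rintro (rfl : k = n a)
  exact hn hv

theorem le_of_mem_vars_of_dvd (h : IsLinearRelation η n R) (hA : A ∣ R) :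
    ∀ v ∈ A.vars, v.2 ≤ n v.1 :=
  fun v hv => h.le_of_mem_vars v (mem_vars_of_dvd h.ne_zero hA hv)

theorem mem_vars_of_dvd_of_aeval_eq_zero (h : IsLinearRelation η n R) (hA : A ∣ R)
    (h0 : aeval (jetValue η) A = 0) (i : σ) : (i, n i) ∈ A.vars :=
  h.mem_vars_of_aeval_eq_zero (ne_zero_of_dvd_ne_zero h.ne_zero hA) (h.le_of_mem_vars_of_dvd hA) h0 i

/-- Minimality forces zᵢ⁽ⁿⁱ⁾ to occur in every factor that vanishes at η, and R has degree at most
one in it. -/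
theorem degreeOf_eq_one (h : IsLinearRelation η n R) (hA : A ∣ R)
    (h0 : aeval (jetValue η) A = 0) (i : σ) : A.degreeOf (i, n i) = 1 := by
  have h1 := mem_vars_iff_degreeOf_ne_zero.1 (h.mem_vars_of_dvd_of_aeval_eq_zero hA h0 i)
  obtain ⟨B, rfl⟩ := hA
  have h2 := h.degreeOf_le i
  rw [degreeOf_mul_eq (left_ne_zero_of_mul h.ne_zero) (right_ne_zero_of_mul h.ne_zero)] at h2
  omega

theorem pderiv_mem_lowVars (h : IsLinearRelation η n R) (hA : A ∣ R)
    (h0 : aeval (jetValue η) A = 0) (i : σ) :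
    pderiv (i, n i) A ∈ supported F (lowVars i (n i)) ∧
      A - X (i, n i) * pderiv (i, n i) A ∈ supported F (lowVars i (n i)) := by
  refine pderiv_mem_supported (fun v hv hne => ?_) (h.degreeOf_eq_one hA h0 i).le
  rintro rfl
  refine lt_of_le_of_ne (h.le_of_mem_vars_of_dvd hA v hv) fun h' => hne ?_
  rw [← h']

theorem aeval_pderiv_ne_zero [CharZero F] (h : IsLinearRelation η n R) (hA : A ∣ R)
    (h0 : aeval (jetValue η) A = 0) (i : σ) : aeval (jetValue η) (pderiv (i, n i) A) ≠ 0 :=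
  fun h' => pderiv_ne_zero (h.degreeOf_eq_one hA h0 i)
    (h.eq_zero_of_mem i _ (h.pderiv_mem_lowVars hA h0 i).1 h')

theorem ordIn_eq [DecidableEq σ] (h : IsLinearRelation η n R) (hA : A ∣ R)
    (h0 : aeval (jetValue η) A = 0) (i : σ) : ordIn i A = n i :=
  ordIn_eq_coe_iff.2 ⟨h.mem_vars_of_dvd_of_aeval_eq_zero hA h0 i,
    fun k hk => h.le_of_mem_vars_of_dvd hA (i, k) hk⟩

theorem exists_irreducible (h : IsLinearRelation η n R) :
    ∃ A, Irreducible A ∧ A ∣ R ∧ aeval (jetValue η) A = 0 := by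
  obtain ⟨s, hs, hprod⟩ := UniqueFactorizationMonoid.exists_prime_factors R h.ne_zero
  have h0 : aeval (jetValue η) s.prod = 0 := by
    obtain ⟨c, hc⟩ := hprod.symm
    rw [← hc, map_mul, h.aeval_eq_zero, zero_mul]
  rw [map_multiset_prod, Multiset.prod_eq_zero_iff, Multiset.mem_map] at h0
  obtain ⟨A, hA, hA0⟩ := h0
  exact ⟨A, (hs A hA).irreducible, (Multiset.dvd_prod hA).trans hprod.dvd, hA0⟩

/-- A cofactor vanishing at η would have the full order of R, so the cofactor of a main factor does
not vanish and A does. Conversely a factor A with A(η) = 0 uses up the degree one in each zᵢ⁽ⁿⁱ⁾,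
which leaves the cofactor of smaller order. -/
theorem isMainFactor_iff (h : IsLinearRelation η n R) :
    IsMainFactor A R ↔ Irreducible A ∧ A ∣ R ∧ aeval (jetValue η) A = 0 := by
  constructor
  · rintro ⟨hirr, B, hR, hB⟩
    refine ⟨hirr, ⟨B, hR⟩, ?_⟩
    have hB0 : aeval (jetValue η) B ≠ 0 := by
      intro h0
      have hBR : B ∣ R := ⟨A, by rw [hR, mul_comm]⟩
      refine hB.not_ge (Finset.sup_le fun v hv => ?_)
      refine le_trans (WithBot.coe_le_coe.2 (h.le_of_mem_vars v hv)) ?_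
      exact Finset.le_sup (f := fun v : σ × ℕ => ((v.2 : ℕ) : WithBot ℕ))
        (h.mem_vars_of_dvd_of_aeval_eq_zero hBR h0 v.1)
    have := h.aeval_eq_zero
    rw [hR, map_mul] at this
    exact (mul_eq_zero.1 this).resolve_right hB0
  · rintro ⟨hirr, hA, h0⟩
    have hdeg := h.degreeOf_eq_one hA h0
    obtain ⟨B, hR⟩ := hA
    refine ⟨hirr, B, hR, ordTotal_lt_of_forall ?_ fun v hv => ?_⟩
    · obtain ⟨v, hv⟩ : A.vars.Nonempty := by
        rw [Finset.nonempty_iff_ne_empty]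
        intro he
        rw [vars_eq_empty_iff_eq_C] at he
        rw [he, aeval_C, map_eq_zero] at h0
        rw [h0, map_zero] at he
        exact hirr.ne_zero he
      exact ⟨v, mem_vars_of_dvd h.ne_zero ⟨B, hR⟩ hv⟩
    · refine ⟨(v.1, n v.1), h.mem_vars_of_aeval_eq_zero h.ne_zero h.le_of_mem_vars
        h.aeval_eq_zero v.1, ?_⟩
      refine lt_of_le_of_ne (h.le_of_mem_vars_of_dvd ⟨A, by rw [hR, mul_comm]⟩ v hv) ?_
      intro h'
      have h1 : B.degreeOf (v.1, n v.1) ≠ 0 := mem_vars_iff_degreeOf_ne_zero.1 (by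
        rw [show n v.1 = v.2 from h'.symm]
        exact hv)
      have h2 := h.degreeOf_le v.1
      have h3 := h.ne_zero
      rw [hR] at h2 h3
      rw [degreeOf_mul_eq (left_ne_zero_of_mul h3) (right_ne_zero_of_mul h3), hdeg] at h2
      omega

variable [Differential F]

theorem diffIdeal_le_ker [DifferentialAlgebra F K] (h0 : aeval (jetValue η) A = 0) :
    diffIdeal A ≤ RingHom.ker (aeval (R := F) (jetValue η)) := by
  refine Ideal.span_le.2 ?_
  rintro _ ⟨k, rfl⟩
  change aeval (jetValue η) (iterDeriv k A) = 0
  rw [← evalAt_eq_aeval, evalAt_iterDeriv, evalAt_eq_aeval, h0, iterDeriv_zero_right]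

/-- A relation f reduces to a remainder of order below nᵢ in zᵢ that still vanishes at η, hence is
zero. The reverse inclusion holds because the separant has order below nᵢ in zᵢ and so does not
vanish at η. -/
theorem isImplicitEquation [DecidableEq σ] [CharZero F] [DifferentialAlgebra F K] (h : IsLinearRelation η n R)
    (hirr : Irreducible A) (hA : A ∣ R) (h0 : aeval (jetValue η) A = 0) :
    IsImplicitEquation η A := by
  refine ⟨hirr, fun i _ => ?_⟩
  have hS : separant i A = pderiv (i, n i) A := separant_eq (h.ordIn_eq hA h0 i)
  ext f
  change evalAt η f = 0 ↔ ∃ k : ℕ, separant i A ^ k * f ∈ diffIdeal A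
  rw [hS, evalAt_eq_aeval]
  have hlow := h.pderiv_mem_lowVars hA h0 i
  constructor
  · intro hf
    obtain ⟨k, r, hr, hk⟩ := exists_pow_mul_sub_mem_diffIdeal hlow.1 hlow.2 f
    have h1 : aeval (jetValue η) (pderiv (i, n i) A ^ k * f - r) = 0 := diffIdeal_le_ker h0 hk
    rw [map_sub, map_mul, hf, mul_zero, zero_sub, neg_eq_zero] at h1
    rw [h.eq_zero_of_mem i r hr h1, sub_zero] at hk
    exact ⟨k, hk⟩
  · rintro ⟨k, hk⟩
    have h1 : aeval (jetValue η) (pderiv (i, n i) A ^ k * f) = 0 := diffIdeal_le_ker h0 hk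
    rw [map_mul, map_pow] at h1
    exact (mul_eq_zero.1 h1).resolve_left (pow_ne_zero _ (h.aeval_pderiv_ne_zero hA h0 i))

end IsLinearRelation

end LinearRelation

/-- Ensures that the family of equalities in `IsImplicitEquation` is not empty. -/
theorem exists_ordIn_ne_bot_of_irreducible {σ F : Type*} [DecidableEq σ] [Field F]
    {A : DiffPoly σ F} (hA : Irreducible A) : ∃ i, ordIn i A ≠ ⊥ := by
  obtain ⟨v, hv⟩ : A.vars.Nonempty := by
    rw [Finset.nonempty_iff_ne_empty]
    intro he
    rw [vars_eq_empty_iff_eq_C] at he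
    have hc : A.coeff 0 ≠ 0 := by
      intro hc
      rw [hc, map_zero] at he
      exact hA.ne_zero he
    exact hA.not_isUnit (he ▸ (isUnit_iff_ne_zero.2 hc).map C)
  refine ⟨v.1, fun h => ?_⟩
  have := coe_le_ordIn (i := v.1) (k := v.2) hv
  rw [h] at this
  exact absurd (WithBot.bot_lt_coe v.2) this.not_gt

/-! ### Uniqueness of the implicit equation -/

section ImplicitEquation

variable {σ F K : Type*} [Field F] [Differential F] [Field K] [Algebra F K]
  [Differential K] {η : σ → K} {A : DiffPoly σ F}

theorem aeval_pderiv_sum_mul_iterDeriv [DifferentialAlgebra F K]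
    (h0 : aeval (jetValue η) A = 0) (c : ℕ →₀ DiffPoly σ F) (v : σ × ℕ) :
    aeval (jetValue η) (pderiv v (c.sum fun j a => a * iterDeriv j A)) =
      ∑ j ∈ c.support, aeval (jetValue η) (c j) * aeval (jetValue η) (pderiv v (iterDeriv j A)) := by
  rw [Finsupp.sum, map_sum, map_sum]
  refine Finset.sum_congr rfl fun j _ => ?_
  have h1 : aeval (jetValue η) (iterDeriv j A) = 0 := by
    rw [← evalAt_eq_aeval, evalAt_iterDeriv, evalAt_eq_aeval, h0, iterDeriv_zero_right]
  rw [Derivation.leibniz, smul_eq_mul, smul_eq_mul, map_add, map_mul, map_mul, h1, zero_mul,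
    add_zero]

variable [DecidableEq σ]

theorem IsImplicitEquation.aeval_eq_zero (hA : IsImplicitEquation η A) {i : σ}
    (hi : ordIn i A ≠ ⊥) : aeval (jetValue η) A = 0 := by
  rw [← evalAt_eq_aeval]
  have h1 : A ∈ satSet i A := ⟨0, by
    rw [pow_zero, one_mul]
    exact Ideal.subset_span (Set.mem_range_self 0)⟩
  rw [← hA.2 i hi] at h1
  exact h1

/-- A separant vanishing at η would lie in the saturation, which would then contain 1. -/
theorem IsImplicitEquation.aeval_separant_ne_zero (hA : IsImplicitEquation η A) {i : σ}
    (hi : ordIn i A ≠ ⊥) : aeval (jetValue η) (separant i A) ≠ 0 := by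
  intro h0
  have h1 : separant i A ∈ {f : DiffPoly σ F | evalAt η f = 0} := by
    change evalAt η _ = 0
    rw [evalAt_eq_aeval, h0]
  rw [hA.2 i hi] at h1
  obtain ⟨k, hk⟩ := h1
  have h2 : (1 : DiffPoly σ F) ∈ satSet i A := ⟨k + 1, by rwa [mul_one, pow_succ]⟩
  rw [← hA.2 i hi] at h2
  have h3 : evalAt η (1 : DiffPoly σ F) = 0 := h2
  rw [evalAt_eq_aeval, map_one] at h3
  exact one_ne_zero h3

/-- By minimality the order a of A in a variable zᵢ that occurs in it is at least nᵢ. If they agree,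
pseudo-division by B proves divisibility; a larger order is impossible, since then B could not lie
in the saturation of A. -/
theorem IsLinearRelation.dvd_of_isImplicitEquation [CharZero F] [DifferentialAlgebra F K]
    {n : σ → ℕ} {R B : DiffPoly σ F} (h : IsLinearRelation η n R) (hB : Irreducible B)
    (hBR : B ∣ R) (hB0 : aeval (jetValue η) B = 0) (hA : IsImplicitEquation η A) : B ∣ A := by
  obtain ⟨i, hi⟩ := exists_ordIn_ne_bot_of_irreducible hA.1
  have hA0 := hA.aeval_eq_zero hi
  have hsep := hA.aeval_separant_ne_zero hi
  obtain ⟨a, ha⟩ := WithBot.ne_bot_iff_exists.1 hi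
  have ha' : ordIn i A = a := ha.symm
  rw [separant_eq ha'] at hsep
  have hAlow : A ∈ supported F (lowVars i (a + 1)) := by
    refine mem_supported.2 ?_
    rintro ⟨b, k⟩ hv (rfl : b = i)
    exact Nat.lt_succ_of_le (ordIn_le_coe_iff.1 ha'.le k hv)
  have hBlow : B ∈ supported F (lowVars i (n i + 1)) := by
    refine mem_supported.2 ?_
    rintro ⟨b, k⟩ hv (rfl : b = i)
    exact Nat.lt_succ_of_le (h.le_of_mem_vars_of_dvd hBR _ hv)
  have hS := h.aeval_pderiv_ne_zero hBR hB0 i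
  have hna : n i ≤ a := by
    by_contra! hlt
    exact hA.1.ne_zero (h.eq_zero_of_mem i A (supported_mono (lowVars_mono i hlt) hAlow) hA0)
  rcases Nat.eq_or_lt_of_le hna with hna | hna
  · have hlow := h.pderiv_mem_lowVars hBR hB0 i
    rw [← hna] at hAlow
    obtain ⟨k, r, hr, hk⟩ := supported_lowVars_le_reducible (J := Ideal.span {B}) hlow.1 hlow.2 1
      (fun j hj => by
        rw [Nat.lt_one_iff.1 hj]
        exact Ideal.mem_span_singleton_self B) hAlow
    rw [Ideal.mem_span_singleton] at hk
    have hr0 : aeval (jetValue η) (pderiv (i, n i) B ^ k * A - r) = 0 := by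
      obtain ⟨c, hc⟩ := hk
      rw [hc, map_mul, hB0, zero_mul]
    rw [map_sub, map_mul, hA0, mul_zero, zero_sub, neg_eq_zero] at hr0
    rw [h.eq_zero_of_mem i r hr hr0, sub_zero] at hk
    refine (hB.prime.dvd_or_dvd hk).resolve_left fun hdvd => ?_
    obtain ⟨c, hc⟩ := hB.prime.dvd_of_dvd_pow hdvd
    rw [hc, map_mul, hB0, zero_mul] at hS
    exact hS rfl
  -- From S_A^k · B = ∑ cⱼ A⁽ʲ⁾, taking any partial derivative at η leaves only the terms in which B
  -- or the A⁽ʲ⁾ are differentiated.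
  · exfalso
    have hmem : B ∈ satSet i A := by
      rw [← hA.2 i hi]
      change evalAt η B = 0
      rw [evalAt_eq_aeval, hB0]
    obtain ⟨k, hk⟩ := hmem
    rw [separant_eq ha', diffIdeal,
      Finsupp.mem_ideal_span_range_iff_exists_finsupp] at hk
    obtain ⟨c, hc⟩ := hk
    have key : ∀ v, aeval (jetValue η) (pderiv (i, a) A) ^ k * aeval (jetValue η) (pderiv v B) =
        ∑ j ∈ c.support, aeval (jetValue η) (c j) *
          aeval (jetValue η) (pderiv v (iterDeriv j A)) := by
      intro v
      rw [← aeval_pderiv_sum_mul_iterDeriv hA0 c v, hc, Derivation.leibniz, smul_eq_mul,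
        smul_eq_mul, map_add, map_mul, map_mul, map_pow, hB0, zero_mul, add_zero]
    -- If all cⱼ vanish at η, the partial derivative in zᵢ⁽ⁿⁱ⁾ contradicts S_B(η) ≠ 0. Otherwise let
    -- J be the last index with c_J(η) ≠ 0: in zᵢ⁽ᵃ⁺ᴶ⁾ the left side is zero, as a + J > nᵢ, while
    -- the right side is c_J(η) S_A(η) ≠ 0.
    by_cases hc0 : ∀ j ∈ c.support, aeval (jetValue η) (c j) = 0
    · have := key (i, n i)
      rw [Finset.sum_eq_zero fun j hj => by rw [hc0 j hj, zero_mul]] at this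
      exact mul_ne_zero (pow_ne_zero k hsep) hS this
    · classical
      push Not at hc0
      obtain ⟨J, hJ, hmax⟩ := Finset.exists_max_image
        (c.support.filter fun j => aeval (jetValue η) (c j) ≠ 0) id
        (by obtain ⟨j, hj⟩ := hc0; exact ⟨j, Finset.mem_filter.2 hj⟩)
      obtain ⟨hJ, hJ0⟩ := Finset.mem_filter.1 hJ
      have := key (i, a + J)
      rw [pderiv_eq_zero_of_mem_supported hBlow (fun h' => by
          have := h' rfl
          simp only at this
          omega), map_zero, mul_zero, Finset.sum_eq_single_of_mem J hJ,
        pderiv_iterDeriv hAlow] at this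
      · exact mul_ne_zero hJ0 hsep this.symm
      · intro j hj hne
        rcases Nat.lt_or_gt_of_ne hne with hlt | hgt
        · rw [pderiv_eq_zero_of_mem_supported (iterDeriv_mem_supported_lowVars hAlow j), map_zero,
            mul_zero]
          intro h'
          have := h' rfl
          simp only at this
          omega
        · by_contra hne0
          have := hmax j (Finset.mem_filter.2 ⟨hj, left_ne_zero_of_mul hne0⟩)
          simp only [id] at this
          omega

theorem IsLinearRelation.isImplicitEquation_iff [CharZero F] [DifferentialAlgebra F K]
    {n : σ → ℕ} {R : DiffPoly σ F} (h : IsLinearRelation η n R) :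
    IsImplicitEquation η A ↔ IsMainFactor A R := by
  rw [h.isMainFactor_iff]
  constructor
  · intro hA
    obtain ⟨B, hB, hBR, hB0⟩ := h.exists_irreducible
    obtain ⟨i, hi⟩ := exists_ordIn_ne_bot_of_irreducible hA.1
    have hBA := hB.associated_of_dvd hA.1 (h.dvd_of_isImplicitEquation hB hBR hB0 hA)
    exact ⟨hA.1, hBA.symm.dvd.trans hBR, hA.aeval_eq_zero hi⟩
  · rintro ⟨hirr, hAR, h0⟩
    exact h.isImplicitEquation hirr hAR h0

theorem IsLinearRelation.exists_isImplicitEquation [CharZero F] [DifferentialAlgebra F K]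
    {n : σ → ℕ} {R : DiffPoly σ F} (h : IsLinearRelation η n R) :
    ∃ A : DiffPoly σ F, IsImplicitEquation η A := by
  obtain ⟨A, hirr, hAR, h0⟩ := h.exists_irreducible
  exact ⟨A, h.isImplicitEquation hirr hAR h0⟩

end ImplicitEquation

/-! ### Application to linear parametrizations -/

section Parametrization

variable {F : Type*} [Field F]

theorem coeff_single_ne_zero_of_mem_vars {f : DiffPoly Unit F} (hf : f.totalDegree ≤ 1) {n : ℕ}
    (hn : ((), n) ∈ f.vars) : f.coeff (Finsupp.single ((), n) 1) ≠ 0 := by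
  intro h0
  obtain ⟨s, hs, hsn⟩ := (mem_vars_iff_mem_support _).1 hn
  have hdeg : s.degree ≤ 1 := (le_totalDegree hs).trans hf
  have hle : Finsupp.single ((), n) 1 ≤ s :=
    Finsupp.single_le_iff.2 (Nat.one_le_iff_ne_zero.2 (Finsupp.mem_support_iff.1 hsn))
  obtain ⟨t, rfl⟩ := exists_add_of_le hle
  rw [map_add, Finsupp.degree_single] at hdeg
  have ht : t = 0 := (Finsupp.degree_eq_zero_iff t).1 (by omega)
  rw [ht, add_zero, mem_support_iff] at hs
  exact hs h0

theorem isLinFrac_of_ratOrd_eq {p q : DiffPoly Unit F} {n : ℕ} (hq : q ≠ 0)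
    (hp1 : p.totalDegree ≤ 1) (hq1 : q.totalDegree ≤ 1) (hpq : IsRelPrime p q)
    (h : ratOrd p q = n) : IsLinFrac p q n where
  num_mem := mem_linForms_of_totalDegree_le hp1 fun k hk => Nat.lt_succ_of_le
    (ordIn_le_coe_iff.1 ((le_max_left _ _).trans h.le) k hk)
  den_mem := mem_linForms_of_totalDegree_le hq1 fun k hk => Nat.lt_succ_of_le
    (ordIn_le_coe_iff.1 ((le_max_right _ _).trans h.le) k hk)
  den_ne_zero := hq
  relPrime := hpq
  leading := by
    unfold ratOrd at h
    rcases max_choice (ordIn () p) (ordIn () q) with h' | h' <;> rw [h'] at h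
    · exact Or.inl (coeff_single_ne_zero_of_mem_vars hp1 (mem_vars_of_ordIn_eq_coe h))
    · exact Or.inr (coeff_single_ne_zero_of_mem_vars hq1 (mem_vars_of_ordIn_eq_coe h))

theorem X_mul_C_sub_C_eq_zero_iff {τ : Type*} {v : τ} {a b : F} :
    (X v * C b - C a : MvPolynomial τ F) = 0 ↔ a = 0 ∧ b = 0 := by
  classical
  constructor
  · intro h
    have hb : b = 0 := by
      have := congrArg (coeff (Finsupp.single v 1)) h
      rw [coeff_sub, mul_comm, coeff_C_mul, coeff_X, if_pos rfl, mul_one, coeff_C, if_neg, sub_zero, coeff_zero] at this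
      · exact this
      · exact (Finsupp.single_ne_zero.2 one_ne_zero).symm
    rw [hb, map_zero, mul_zero, zero_sub, neg_eq_zero, C_eq_zero] at h
    exact ⟨h, hb⟩
  · rintro ⟨rfl, rfl⟩
    simp

variable (P Q : Fin 2 → DiffPoly Unit F)

/-- No cancellation occurs: z b - a with a, b in F is zero only if both are. Hence the resultant is
formed with the orders of the fractions. -/
theorem vars_paramPoly (i : Fin 2) : (paramPoly P Q i).vars = (P i).vars ∪ (Q i).vars := by
  ext v
  have hcoeff : ∀ s, (paramPoly P Q i).coeff s = 0 ↔ (P i).coeff s = 0 ∧ (Q i).coeff s = 0 := by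
    intro s
    rw [paramPoly, coeff_sub, coeff_C_mul, coeff_map, coeff_map]
    exact X_mul_C_sub_C_eq_zero_iff
  simp only [Finset.mem_union, mem_vars_iff_mem_support, mem_support_iff, ne_eq, hcoeff,
    not_and_or, or_and_right, exists_or]

theorem ordIn_paramPoly (i : Fin 2) : ordIn () (paramPoly P Q i) = ratOrd (P i) (Q i) := by
  unfold ratOrd ordIn
  rw [vars_paramPoly, Finset.filter_union, Finset.sup_union]

variable {P Q} {m : Fin 2 → ℕ}

theorem paramResultant_eq_det [Differential F] (hm : ∀ i, ratOrd (P i) (Q i) = (m i : WithBot ℕ)) :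
    paramResultant P Q = (paramMatrix P Q (m 0) (m 1)).det := by
  rw [paramResultant, diffResultant, ordIn_paramPoly, ordIn_paramPoly, hm, hm]
  rfl

variable [Differential F]

theorem notMem_cutVars (m₁ m₂ : ℕ) (i : Fin 2) : (i, topOrd m₁ m₂ i) ∉ cutVars m₁ m₂ i :=
  fun h => lt_irrefl _ (h.2 rfl)

theorem topCoeff_ne_zero_of_mem_vars {m₁ m₂ : ℕ} {i : Fin 2}
    (h : (i, topOrd m₁ m₂ i) ∈ (paramMatrix P Q m₁ m₂).det.vars) :
    topCoeff P Q m₁ m₂ i ≠ 0 := by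
  intro h0
  obtain ⟨T, hT, hdet⟩ := det_paramMatrix_eq_add P Q m₁ m₂ i
  rw [h0, mul_zero, zero_add] at hdet
  rw [hdet] at h
  exact notMem_cutVars m₁ m₂ i (mem_supported.1 hT h)

/-- The determinant is linear in the highest derivative of zᵢ, so its vanishing can be solved for
that variable over the fraction field, with the variables in `cutVars` left untouched. -/
theorem exists_algHom_det_paramMatrix_eq_zero {m₁ m₂ : ℕ} {i : Fin 2}
    (h : topCoeff P Q m₁ m₂ i ≠ 0) :
    ∃ φ : DiffPoly (Fin 2) F →ₐ[F] FractionRing (DiffPoly (Fin 2) F),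
      (AlgebraicIndependent F fun v : cutVars m₁ m₂ i => φ (X (v : Fin 2 × ℕ))) ∧
        φ (paramMatrix P Q m₁ m₂).det = 0 ∧ φ (topCoeff P Q m₁ m₂ i) ≠ 0 := by
  classical
  obtain ⟨T, hT, hdet⟩ := det_paramMatrix_eq_add P Q m₁ m₂ i
  let ψ : DiffPoly (Fin 2) F →ₐ[F] FractionRing (DiffPoly (Fin 2) F) :=
    IsScalarTower.toAlgHom F _ _
  have hψ : Function.Injective ψ := IsFractionRing.injective _ _
  let φ : DiffPoly (Fin 2) F →ₐ[F] FractionRing (DiffPoly (Fin 2) F) :=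
    aeval fun v => if v = (i, topOrd m₁ m₂ i) then -ψ T / ψ (topCoeff P Q m₁ m₂ i) else ψ (X v)
  have hX : ∀ v ∈ cutVars m₁ m₂ i, φ (X v) = ψ (X v) := by
    intro v hv
    rw [aeval_X, if_neg]
    rintro rfl
    exact notMem_cutVars m₁ m₂ i hv
  have hle : supported F (cutVars m₁ m₂ i) ≤ AlgHom.equalizer φ ψ := by
    rw [supported_eq_adjoin_X]
    refine Algebra.adjoin_le ?_
    rintro _ ⟨v, hv, rfl⟩
    exact hX v hv
  have hφ : ∀ f ∈ supported F (cutVars m₁ m₂ i), φ f = ψ f := fun f hf => hle hf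
  have hne : ψ (topCoeff P Q m₁ m₂ i) ≠ 0 := (map_ne_zero_iff ψ hψ).2 h
  refine ⟨φ, ?_, ?_, ?_⟩
  · have h1 : AlgebraicIndependent F fun v : cutVars m₁ m₂ i => ψ (X (v : Fin 2 × ℕ)) :=
      ((algebraicIndependent_X (Fin 2 × ℕ) F).comp _ Subtype.val_injective).map' hψ
    convert h1 using 2 with v
    exact hX v v.2
  · rw [hdet, map_add, map_mul, hφ _ (topCoeff_mem_supported P Q m₁ m₂ i), hφ T hT, aeval_X,
      if_pos rfl, div_mul_cancel₀ _ hne, neg_add_cancel]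
  · rwa [hφ _ (topCoeff_mem_supported P Q m₁ m₂ i)]

variable {K : Type*} [Field K] [Algebra F K] [Differential K] [DifferentialAlgebra F K] {u : K}

theorem topOrd_of_ne (m : Fin 2 → ℕ) {i j : Fin 2} (h : i ≠ j) : topOrd (m 0) (m 1) i = m j := by
  unfold topOrd
  fin_cases i <;> fin_cases j <;> simp_all

theorem isProperParam_of_mem_vars [CharZero F] (hu : DiffTranscendental F u)
    (h : ∀ i, IsLinFrac (P i) (Q i) (m i))
    (hR : (0, topOrd (m 0) (m 1) 0) ∈ (paramMatrix P Q (m 0) (m 1)).det.vars) :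
    IsProperParam u P Q := by
  obtain ⟨φ, h1, h2, h3⟩ :=
    exists_algHom_det_paramMatrix_eq_zero (topCoeff_ne_zero_of_mem_vars hR)
  exact isProperParam_of_topCoeff_ne_zero hu h (aeval_topCoeff_ne_zero hu h h1 h2 h3)

theorem IsProperParam.isLinearRelation [CharZero F] (hu : DiffTranscendental F u)
    (h : ∀ i, IsLinFrac (P i) (Q i) (m i)) (hprop : IsProperParam u P Q) :
    IsLinearRelation (paramPoint u P Q) (topOrd (m 0) (m 1))
      (paramMatrix P Q (m 0) (m 1)).det := by
  classical
  have hfree : ∀ i, ∀ f ∈ supported F (lowVars i (topOrd (m 0) (m 1) i)),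
      aeval (jetValue (paramPoint u P Q)) f = 0 → f = 0 := by
    intro i f hf h0
    -- The bound in zᵢ is the order of the fraction with the other index j.
    obtain ⟨j, hj⟩ := exists_ne i
    rw [topOrd_of_ne m hj.symm] at hf
    rw [← evalAt_eq_aeval] at h0
    exact eq_zero_of_evalAt_eq_zero hu (isProperParam_iff.1 hprop) hj.symm (h j).num_mem
      (h j).den_mem (h j).relPrime (h j).leading (paramPoint_mul hu h j) hf h0
  refine ⟨?_, ?_, hfree, ?_, ?_⟩
  · refine det_paramMatrix_ne_zero hu h fun f hf => hfree 0 f (supported_mono ?_ hf)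
    rintro v ⟨-, hv⟩
    exact hv
  · have h1 := Matrix.map_det_mul
      ((aeval (jetValue (paramPoint u P Q)) : DiffPoly (Fin 2) F →ₐ[F] K) :
        DiffPoly (Fin 2) F →+* K) (paramMatrix P Q (m 0) (m 1))
      (jetVec (m 0 + m 1) fun k => iterDeriv k u) (Fin.last _)
    simp only [RingHom.coe_coe] at h1
    rw [Finset.sum_eq_zero fun r _ => by rw [sum_paramMatrix_mul_jetVec hu h, mul_zero],
      show jetVec (m 0 + m 1) (fun k => iterDeriv k u) (Fin.last _) = 1 by simp [jetVec],
      mul_one] at h1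
    exact h1
  · intro v hv
    exact mem_supported.1 (det_paramMatrix_mem_supported P Q (m 0) (m 1)) hv
  · intro i
    obtain ⟨T, hT, hdet⟩ := det_paramMatrix_eq_add P Q (m 0) (m 1) i
    rw [hdet]
    exact degreeOf_X_mul_add_le (notMem_cutVars _ _ i) (topCoeff_mem_supported P Q _ _ i) hT

end Parametrization

theorem mainTheorem3 {F K : Type*} [Field F] [CharZero F] [Differential F]
    [Field K] [Algebra F K] [Differential K] [DifferentialAlgebra F K]
    (u : K) (hu : DiffTranscendental F u)
    (P Q : Fin 2 → DiffPoly Unit F) (hPQ : IsLinearParam P Q)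
    (m : Fin 2 → ℕ) (hm : ∀ i, ratOrd (P i) (Q i) = (m i : WithBot ℕ)) :
    -- the resultant is the determinant of an explicit matrix of size `m 0 + m 1 + 2`
    paramResultant P Q =
        (diffResMatrix (paramPoly P Q 0) (paramPoly P Q 1) (m 0) (m 1)).det ∧
    -- the criterion for properness
    (IsProperParam u P Q ↔
      paramResultant P Q ≠ 0 ∧
        ordIn 0 (paramResultant P Q) = ratOrd (P 1) (Q 1) ∧
        ordIn 1 (paramResultant P Q) = ratOrd (P 0) (Q 0)) ∧
    -- when the test succeeds, the implicit equation is the main factor of the resultant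
    (paramResultant P Q ≠ 0 →
      ordIn 0 (paramResultant P Q) = ratOrd (P 1) (Q 1) →
      ordIn 1 (paramResultant P Q) = ratOrd (P 0) (Q 0) →
        (∃ A : DiffPoly (Fin 2) F, IsImplicitEquation (paramPoint u P Q) A) ∧
        ∀ A : DiffPoly (Fin 2) F,
          IsImplicitEquation (paramPoint u P Q) A ↔ IsMainFactor A (paramResultant P Q)) := by
  have h : ∀ i, IsLinFrac (P i) (Q i) (m i) := fun i => isLinFrac_of_ratOrd_eq
    (hPQ.den_ne_zero i) (hPQ.num_degree_le i) (hPQ.den_degree_le i) (hPQ.reduced i) (hm i)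
  have hdet := paramResultant_eq_det hm
  have hproper : ordIn 0 (paramResultant P Q) = ratOrd (P 1) (Q 1) → IsProperParam u P Q := by
    intro h0
    rw [hm] at h0
    -- Since `topOrd (m 0) (m 1) 0` is `m 1`, the order of R in x says exactly that the top variable
    -- occurs.
    refine isProperParam_of_mem_vars hu h ?_
    rw [← hdet]
    exact mem_vars_of_ordIn_eq_coe h0
  refine ⟨hdet, ⟨fun hp => ?_, fun h' => hproper h'.2.1⟩, fun _ h0 _ => ?_⟩
  · have hrel := hp.isLinearRelation hu h
    rw [← hdet] at hrel
    rw [hm, hm]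
    exact ⟨hrel.ne_zero, hrel.ordIn_eq dvd_rfl hrel.aeval_eq_zero 0,
      hrel.ordIn_eq dvd_rfl hrel.aeval_eq_zero 1⟩
  · have hrel := (hproper h0).isLinearRelation hu h
    rw [← hdet] at hrel
    exact ⟨hrel.exists_isImplicitEquation, fun A => hrel.isImplicitEquation_iff⟩
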